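/- Let $d\ge 1$, let $\Omega\subset\mathbb R^d$ be a bounded open set (for instance a bounded Lipschitz domain) and $T>0$. Write $\langle\cdot,\cdot\rangle$, $\|\cdot\|$ for the inner product and norm of $L^2(\Omega)$ or $L^2(\Omega)^d$, and let $H(\mathrm{div};\Omega)$ be the space of $\mathbf v\in L^2(\Omega)^d$ with distributional divergence $\nabla\cdot\mathbf v\in L^2(\Omega)$, with its usual norm. Let $s,a,f_w,f_2:\mathbb R\to\mathbb R$ and $\mathbf f_1,\mathbf f_3:\mathbb R\to\mathbb R^d$ be Lipschitz continuous, where $s$ is nondecreasing with values in $[0,1]$, $0<a_\star\le a\le a^\star<\infty$ for some constants $a_\star,a^\star$, and $f_w$ is bounded. Let $\Theta_I\in L^2(\Omega)$ and $M_{\mathbf u}\in\mathbb R$. A solution of Problem $P$ consists of $\Theta,p\in L^2(0,T;L^2(\Omega))$, $\mathbf q\in L^2(0,T;L^2(\Omega)^d)$, $\mathbf u\in L^2(0,T;H(\mathrm{div};\Omega))$ with $s(\Theta)\in L^\infty(\Omega\times(0,T))$, $t\mapsto\int_0^t\mathbf q\,dy\in C([0,T];H(\mathrm{div};\Omega))$,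 $\Theta(0)=\Theta_I$, and for all $t\in(0,T]$, $w\in L^2(\Omega)$, $\mathbf v\in H(\mathrm{div};\Omega)$ $$\langle s(\Theta(t))-s(\Theta_I),w\rangle+\Big\langle\nabla\cdot\int_0^t\mathbf q\,dy,w\Big\rangle=0,$$ $$\Big\langle\int_0^t\mathbf q\,dy,\mathbf v\Big\rangle-\Big\langle\int_0^t\Theta\,dy,\nabla\cdot\mathbf v\Big\rangle-\Big\langle\int_0^t f_w(s(\Theta))\mathbf u\,dy,\mathbf v\Big\rangle=\Big\langle\int_0^t\mathbf f_1(s(\Theta))\,dy,\mathbf v\Big\rangle,$$ $$\langle\nabla\cdot\mathbf u(t),w\rangle=\langle f_2(s(\Theta(t))),w\rangle,$$ $$\langle a(s(\Theta(t)))\mathbf u(t),\mathbf v\rangle-\langle p(t),\nabla\cdot\mathbf v\rangle+\langle\mathbf f_3(s(\Theta(t))),\mathbf v\rangle=0.$$ For an integer $N\ge1$ let $\tau=T/N$, $t_n=n\tau$, and $\bar g^n=\frac1\tau\int_{t_{n-1}}^{t_n}g(t)\,dt$. A semi-discrete solution consists of $\Theta^0=\Theta_I$ and, for $n=1,\dots,N$,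 $\Theta^n,p^n\in L^2(\Omega)$ and $\mathbf q^n,\mathbf u^n\in H(\mathrm{div};\Omega)$ such that for all $w\in L^2(\Omega)$, $\mathbf v\in H(\mathrm{div};\Omega)$ $$\langle s(\Theta^n)-s(\Theta^{n-1}),w\rangle+\tau\langle\nabla\cdot\mathbf q^n,w\rangle=0,$$ $$\langle\mathbf q^n,\mathbf v\rangle-\langle\Theta^n,\nabla\cdot\mathbf v\rangle-\langle f_w(s(\Theta^n))\mathbf u^n,\mathbf v\rangle=\langle\mathbf f_1(s(\Theta^n)),\mathbf v\rangle,$$ $$\langle\nabla\cdot\mathbf u^n,w\rangle=\langle f_2(s(\Theta^n)),w\rangle,$$ $$\langle a(s(\Theta^n))\mathbf u^n,\mathbf v\rangle-\langle p^n,\nabla\cdot\mathbf v\rangle+\langle\mathbf f_3(s(\Theta^n)),\mathbf v\rangle=0.$$ Then there are constants $C>0$ and $\tau_0>0$, depending only on the data $d,\Omega,T,s,a,f_w,\mathbf f_1,f_2,\mathbf f_3,\Theta_I,M_{\mathbf u}$, such that for every solution $(\Theta,\mathbf q,p,\mathbf u)$ of Problem $P$ with $|\mathbf u|\le M_{\mathbf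 u}$ almost everywhere in $\Omega\times(0,T)$, every $N\ge1$ with $\tau=T/N\le\tau_0$, and every semi-discrete solution $(\Theta^n,\mathbf q^n,p^n,\mathbf u^n)_{1\le n\le N}$, $$\sum_{n=1}^N\int_{t_{n-1}}^{t_n}\langle s(\Theta(t))-s(\Theta^n),\Theta(t)-\Theta^n\rangle\,dt+\Big\|\sum_{n=1}^N\int_{t_{n-1}}^{t_n}(\mathbf q-\mathbf q^n)\,dt\Big\|^2+\sum_{n=1}^N\Big\|\int_{t_{n-1}}^{t_n}(\mathbf q-\mathbf q^n)\,dt\Big\|^2\le C\tau,$$ $$\tau\|\bar{\mathbf u}^n-\mathbf u^n\|^2+\tau\|\bar p^n-p^n\|^2\le C\int_{t_{n-1}}^{t_n}\|s(\Theta(t))-s(\Theta^n)\|^2\,dt\qquad(n=1,\dots,N),$$ $$\Big\|\sum_{n=1}^N\int_{t_{n-1}}^{t_n}(\Theta(t)-\Theta^n)\,dt\Big\|^2\le C\tau.$$ -/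

import Mathlib

open MeasureTheory Set
open scoped ContDiff InnerProductSpace

noncomputable section

namespace TwoPhase

/-- The Euclidean space `ℝ^d`. -/
abbrev Space (d : ℕ) : Type := EuclideanSpace ℝ (Fin d)

/-- `L²(Ω)`. -/
abbrev L2 {d : ℕ} (Ω : Set (Space d)) : Type :=
  Lp ℝ 2 ((volume : Measure (Space d)).restrict Ω)

/-- `L²(Ω)^d`. -/
abbrev L2vec {d : ℕ} (Ω : Set (Space d)) : Type :=
  Lp (Space d) 2 ((volume : Measure (Space d)).restrict Ω)

/-- `g` is the distributional divergence of `v` on `Ω`. -/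
def IsWeakDiv {d : ℕ} (Ω : Set (Space d)) (v : L2vec Ω) (g : L2 Ω) : Prop :=
  ∀ φ : Space d → ℝ, ContDiff ℝ ∞ φ → HasCompactSupport φ → tsupport φ ⊆ Ω →
    ∫ x in Ω, ⟪v x, gradient φ x⟫_ℝ = - ∫ x in Ω, g x * φ x

theorem gradient_memLp {d : ℕ} (Ω : Set (Space d)) {φ : Space d → ℝ} (h : ContDiff ℝ ∞ φ)
    (hc : HasCompactSupport φ) :
    MemLp (gradient φ) 2 ((volume : Measure (Space d)).restrict Ω) := by
  have hcont : Continuous (gradient φ) :=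
    (InnerProductSpace.toDual ℝ (Space d)).symm.continuous.comp (h.continuous_fderiv (by simp))
  have hsupp : HasCompactSupport (gradient φ) :=
    (hc.fderiv (𝕜 := ℝ)).comp_left (g := (InnerProductSpace.toDual ℝ (Space d)).symm) (by simp)
  exact (hcont.memLp_of_hasCompactSupport hsupp).restrict Ω

theorem testFun_memLp {d : ℕ} (Ω : Set (Space d)) {φ : Space d → ℝ} (h : ContDiff ℝ ∞ φ)
    (hc : HasCompactSupport φ) :
    MemLp φ 2 ((volume : Measure (Space d)).restrict Ω) :=
  (h.continuous.memLp_of_hasCompactSupport hc).restrict Ω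

theorem integral_inner_gradient {d : ℕ} (Ω : Set (Space d)) {φ : Space d → ℝ}
    (h : ContDiff ℝ ∞ φ) (hc : HasCompactSupport φ) (v : L2vec Ω) :
    ∫ x in Ω, ⟪v x, gradient φ x⟫_ℝ = ⟪v, (gradient_memLp Ω h hc).toLp _⟫_ℝ := by
  rw [L2.inner_def]
  refine integral_congr_ae ?_
  filter_upwards [(gradient_memLp Ω h hc).coeFn_toLp] with x hx
  rw [hx]

theorem integral_mul_testFun {d : ℕ} (Ω : Set (Space d)) {φ : Space d → ℝ}
    (h : ContDiff ℝ ∞ φ) (hc : HasCompactSupport φ) (g : L2 Ω) :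
    ∫ x in Ω, g x * φ x = ⟪g, (testFun_memLp Ω h hc).toLp _⟫_ℝ := by
  rw [L2.inner_def]
  refine integral_congr_ae ?_
  filter_upwards [(testFun_memLp Ω h hc).coeFn_toLp] with x hx
  rw [hx]
  simp [mul_comm]

/-- The graph of the distributional divergence in `L²(Ω)^d × L²(Ω)`. -/
def divGraph {d : ℕ} (Ω : Set (Space d)) : Submodule ℝ (WithLp 2 (L2vec Ω × L2 Ω)) where
  carrier := {z | IsWeakDiv Ω z.fst z.snd}
  add_mem' := by
    intro y z hy hz φ h hc hs
    have h1 := hy φ h hc hs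
    have h2 := hz φ h hc hs
    rw [integral_inner_gradient Ω h hc, integral_mul_testFun Ω h hc] at *
    rw [WithLp.add_fst, WithLp.add_snd, inner_add_left, inner_add_left, h1, h2]
    ring
  zero_mem' := by
    intro φ h hc hs
    rw [integral_inner_gradient Ω h hc, integral_mul_testFun Ω h hc]
    simp
  smul_mem' := by
    intro c z hz φ h hc hs
    have h1 := hz φ h hc hs
    rw [integral_inner_gradient Ω h hc, integral_mul_testFun Ω h hc] at *
    rw [WithLp.smul_fst, WithLp.smul_snd, real_inner_smul_left, real_inner_smul_left, h1]
    ring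

/-- `H(div; Ω)`, realized as the space of pairs `(v, ∇·v)` with `v ∈ L²(Ω)^d` and distributional
divergence `∇·v ∈ L²(Ω)`. The norm inherited from the Hilbert product is the usual
`‖v‖_div = (‖v‖² + ‖∇·v‖²)^{1/2}`. -/
abbrev Hdiv {d : ℕ} (Ω : Set (Space d)) : Type := divGraph Ω

/-- The `L²` vector field underlying an element of `H(div; Ω)`. -/
def Hdiv.field {d : ℕ} {Ω : Set (Space d)} (v : Hdiv Ω) : L2vec Ω := v.1.fst

/-- The divergence of an element of `H(div; Ω)`. -/
def Hdiv.div {d : ℕ} {Ω : Set (Space d)} (v : Hdiv Ω) : L2 Ω := v.1.snd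

open Classical in
/-- The `L²(Ω)` class of a square integrable function (`0` for any other function). It is only
applied to functions which are square integrable under the standing assumptions, see
`Coeffs.Admissible.memLp_comp` and `Coeffs.Admissible.memLp_smul`. -/
def toL2 {d : ℕ} {F : Type*} [NormedAddCommGroup F] (Ω : Set (Space d)) (g : Space d → F) :
    Lp F 2 ((volume : Measure (Space d)).restrict Ω) :=
  if h : MemLp g 2 ((volume : Measure (Space d)).restrict Ω) then h.toLp g else 0

/-- The coefficient functions of the two-phase flow model. -/
structure Coeffs (d : ℕ) where
  s : ℝ → ℝ
  a : ℝ → ℝ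
  fw : ℝ → ℝ
  f1 : ℝ → Space d
  f2 : ℝ → ℝ
  f3 : ℝ → Space d

/-- The assumptions on the coefficient functions. -/
structure Coeffs.Admissible {d : ℕ} (c : Coeffs d) : Prop where
  s_mem : ∀ y, c.s y ∈ Icc (0 : ℝ) 1
  s_mono : Monotone c.s
  s_lip : ∃ K, LipschitzWith K c.s
  a_lip : ∃ K, LipschitzWith K c.a
  a_bounds : ∃ aLow aUp : ℝ, 0 < aLow ∧ ∀ y, aLow ≤ c.a y ∧ c.a y ≤ aUp
  f1_lip : ∃ K, LipschitzWith K c.f1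
  f2_lip : ∃ K, LipschitzWith K c.f2
  f3_lip : ∃ K, LipschitzWith K c.f3
  fw_lip : ∃ K, LipschitzWith K c.fw
  fw_bdd : ∃ M, ∀ y, |c.fw y| ≤ M

/-- `s(θ)`. -/
def Coeffs.sat {d : ℕ} (c : Coeffs d) {Ω : Set (Space d)} (θ : L2 Ω) : L2 Ω :=
  toL2 Ω fun x => c.s (θ x)

/-- `a(s(θ)) v`. -/
def Coeffs.aMul {d : ℕ} (c : Coeffs d) {Ω : Set (Space d)} (θ : L2 Ω) (v : L2vec Ω) : L2vec Ω :=
  toL2 Ω fun x => c.a (c.s (θ x)) • v x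

/-- `f_w(s(θ)) v`. -/
def Coeffs.fwMul {d : ℕ} (c : Coeffs d) {Ω : Set (Space d)} (θ : L2 Ω) (v : L2vec Ω) : L2vec Ω :=
  toL2 Ω fun x => c.fw (c.s (θ x)) • v x

/-- `f₁(s(θ))`. -/
def Coeffs.f1Sat {d : ℕ} (c : Coeffs d) {Ω : Set (Space d)} (θ : L2 Ω) : L2vec Ω :=
  toL2 Ω fun x => c.f1 (c.s (θ x))

/-- `f₂(s(θ))`. -/
def Coeffs.f2Sat {d : ℕ} (c : Coeffs d) {Ω : Set (Space d)} (θ : L2 Ω) : L2 Ω :=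
  toL2 Ω fun x => c.f2 (c.s (θ x))

/-- `f₃(s(θ))`. -/
def Coeffs.f3Sat {d : ℕ} (c : Coeffs d) {Ω : Set (Space d)} (θ : L2 Ω) : L2vec Ω :=
  toL2 Ω fun x => c.f3 (c.s (θ x))

/-- On a bounded set, the superposition of a continuous function with the saturation is
square integrable. With `g = id` this covers `s(θ)` itself. -/
theorem Coeffs.Admissible.memLp_comp {d : ℕ} {c : Coeffs d} (hc : c.Admissible)
    {Ω : Set (Space d)} (hΩ : Bornology.IsBounded Ω) {F : Type*} [NormedAddCommGroup F]
    {g : ℝ → F} (hg : Continuous g) (θ : L2 Ω) :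
    MemLp (fun x => g (c.s (θ x))) 2 ((volume : Measure (Space d)).restrict Ω) := by
  obtain ⟨K, hK⟩ := hc.s_lip
  obtain ⟨M, hM⟩ := (isCompact_Icc (a := (0 : ℝ)) (b := 1)).exists_bound_of_continuousOn
    hg.continuousOn
  have : IsFiniteMeasure ((volume : Measure (Space d)).restrict Ω) :=
    ⟨by simpa using hΩ.measure_lt_top⟩
  exact MemLp.of_bound
    ((hg.comp hK.continuous).comp_aestronglyMeasurable (Lp.aestronglyMeasurable θ)) M
    (Filter.Eventually.of_forall fun x => hM _ (hc.s_mem _))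

theorem Coeffs.Admissible.memLp_smul {d : ℕ} {c : Coeffs d} (hc : c.Admissible)
    {Ω : Set (Space d)} {g : ℝ → ℝ} (hg : Continuous g) (θ : L2 Ω) (v : L2vec Ω) :
    MemLp (fun x => g (c.s (θ x)) • v x) 2 ((volume : Measure (Space d)).restrict Ω) := by
  obtain ⟨K, hK⟩ := hc.s_lip
  obtain ⟨M, hM⟩ := (isCompact_Icc (a := (0 : ℝ)) (b := 1)).exists_bound_of_continuousOn
    hg.continuousOn
  refine (Lp.memLp v).of_le_mul (c := M) ?_ ?_
  · exact ((hg.comp hK.continuous).comp_aestronglyMeasurable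
      (Lp.aestronglyMeasurable θ)).smul (Lp.aestronglyMeasurable v)
  · refine Filter.Eventually.of_forall fun x => ?_
    rw [norm_smul]
    exact mul_le_mul_of_nonneg_right (hM _ (hc.s_mem _)) (norm_nonneg _)

/-- `g ∈ L²(0, T; X)`. -/
def MemL2Time {X : Type*} [NormedAddCommGroup X] (T : ℝ) (g : ℝ → X) : Prop :=
  MemLp g 2 ((volume : Measure ℝ).restrict (Ioo 0 T))

/-- The continuous mixed variational problem: `(Θ, q, p, u)` is a solution with initial value
`ΘI`. The function `Q` is `t ↦ ∫₀ᵗ q`, as a continuous function with values in `H(div; Ω)`. -/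
structure IsContinuousSolution {d : ℕ} (c : Coeffs d) (Ω : Set (Space d)) (T : ℝ) (ΘI : L2 Ω)
    (Θ : ℝ → L2 Ω) (q : ℝ → L2vec Ω) (p : ℝ → L2 Ω) (u : ℝ → Hdiv Ω) : Prop where
  Θ_mem : MemL2Time T Θ
  q_mem : MemL2Time T q
  p_mem : MemL2Time T p
  u_mem : MemL2Time T u
  sat_bdd : ∃ M : ℝ, ∀ᵐ t ∂((volume : Measure ℝ).restrict (Ioo 0 T)),
    ∀ᵐ x ∂((volume : Measure (Space d)).restrict Ω), |c.s (Θ t x)| ≤ M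
  init : Θ 0 = ΘI
  mass : ∃ Q : ℝ → Hdiv Ω, ContinuousOn Q (Icc 0 T) ∧
    (∀ t ∈ Icc 0 T, (Q t).field = ∫ y in (0 : ℝ)..t, q y) ∧
    ∀ t ∈ Ioc 0 T, ∀ w : L2 Ω,
      ⟪c.sat (Θ t) - c.sat ΘI, w⟫_ℝ + ⟪(Q t).div, w⟫_ℝ = 0
  flux : ∀ t ∈ Ioc 0 T, ∀ v : Hdiv Ω,
    ⟪∫ y in (0 : ℝ)..t, q y, v.field⟫_ℝ - ⟪∫ y in (0 : ℝ)..t, Θ y, v.div⟫_ℝ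
        - ⟪∫ y in (0 : ℝ)..t, c.fwMul (Θ y) (u y).field, v.field⟫_ℝ
      = ⟪∫ y in (0 : ℝ)..t, c.f1Sat (Θ y), v.field⟫_ℝ
  totalMass : ∀ t ∈ Ioc 0 T, ∀ w : L2 Ω, ⟪(u t).div, w⟫_ℝ = ⟪c.f2Sat (Θ t), w⟫_ℝ
  darcy : ∀ t ∈ Ioc 0 T, ∀ v : Hdiv Ω,
    ⟪c.aMul (Θ t) (u t).field, v.field⟫_ℝ - ⟪p t, v.div⟫_ℝ + ⟪c.f3Sat (Θ t), v.field⟫_ℝ = 0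

/-- One step of the implicit Euler scheme: `(Θ, q, p, u)` solves the semi-discrete mixed problem
with step size `τ` and previous value `Θprev`. -/
structure IsSemiDiscreteStep {d : ℕ} (c : Coeffs d) (Ω : Set (Space d)) (τ : ℝ) (Θprev : L2 Ω)
    (Θ : L2 Ω) (q : Hdiv Ω) (p : L2 Ω) (u : Hdiv Ω) : Prop where
  mass : ∀ w : L2 Ω, ⟪c.sat Θ - c.sat Θprev, w⟫_ℝ + τ * ⟪q.div, w⟫_ℝ = 0
  flux : ∀ v : Hdiv Ω,
    ⟪q.field, v.field⟫_ℝ - ⟪Θ, v.div⟫_ℝ - ⟪c.fwMul Θ u.field, v.field⟫_ℝ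
      = ⟪c.f1Sat Θ, v.field⟫_ℝ
  totalMass : ∀ w : L2 Ω, ⟪u.div, w⟫_ℝ = ⟪c.f2Sat Θ, w⟫_ℝ
  darcy : ∀ v : Hdiv Ω,
    ⟪c.aMul Θ u.field, v.field⟫_ℝ - ⟪p, v.div⟫_ℝ + ⟪c.f3Sat Θ, v.field⟫_ℝ = 0

/-- `(Θⁿ, qⁿ, pⁿ, uⁿ)`, `1 ≤ n ≤ N`, solve the semi-discrete problems successively, starting from
`Θ⁰ = ΘI`. The values `q 0`, `p 0`, `u 0` and all values with index above `N` are irrelevant. -/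
def IsSemiDiscreteSolution {d : ℕ} (c : Coeffs d) (Ω : Set (Space d)) (τ : ℝ) (N : ℕ) (ΘI : L2 Ω)
    (Θ : ℕ → L2 Ω) (q : ℕ → Hdiv Ω) (p : ℕ → L2 Ω) (u : ℕ → Hdiv Ω) : Prop :=
  Θ 0 = ΘI ∧
    ∀ n ∈ Finset.Icc 1 N, IsSemiDiscreteStep c Ω τ (Θ (n - 1)) (Θ n) (q n) (p n) (u n)

/-- The `n`-th time point `t_n = n τ`. -/
def timePoint (τ : ℝ) (n : ℕ) : ℝ := n * τ

/-- The time average `τ⁻¹ ∫_{t_{n-1}}^{t_n} g(t) dt`, for `n ≥ 1`. -/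
def timeMean {X : Type*} [NormedAddCommGroup X] [NormedSpace ℝ X] (τ : ℝ) (g : ℝ → X) (n : ℕ) :
    X :=
  τ⁻¹ • ∫ t in timePoint τ (n - 1)..timePoint τ n, g t

end TwoPhase

end

/-!
Testing the saturation equation against the solution dissipates the Legendre energy
`⟪x, S x⟫ - Φ x` of the potential `Φ` of the saturation map `S`, in continuous as in discrete time,
and this bounds the flux in `L²` independently of the step size. The continuous equation holds only
in integrated form, so there the flux is replaced by its Steklov means, which are the difference
quotients of its primitive.

The error equation is integrated over a time step and tested with the accumulated flux error. The
flux terms telescope by polarization, the saturation terms have a sign, and the difference of the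
lower order fluxes is absorbed because `S` is cocoercive; an implicit discrete Grönwall inequality
then leaves only the `O(τ)` contribution of the energy bounds. The lower order fluxes can be
compared because velocity and pressure solve a mixed Darcy problem, which is stable under
perturbations of the saturation as long as one of the two velocities is bounded.

The pressure and the time-integrated `Θ` are recovered from the inf-sup condition: on a bounded set
Poincaré's inequality and the Riesz representation theorem make `∇· : H(div) → L²` surjective with a
bounded right inverse.
-/

noncomputable section

namespace TwoPhase

open Filter Topology

section SquareIntegrable

variable {α X : Type*} [MeasurableSpace α] {μ : Measure α} [NormedAddCommGroup X]

theorem integrable_norm_sq {f : α → X} (hf : MemLp f 2 μ) : Integrable (fun t => ‖f t‖ ^ 2) μ :=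
  hf.integrable_norm_pow two_ne_zero

theorem norm_sq_integral_le [NormedSpace ℝ X] [IsFiniteMeasure μ] {f : α → X} (hf : MemLp f 2 μ) :
    ‖∫ t, f t ∂μ‖ ^ 2 ≤ μ.real univ * ∫ t, ‖f t‖ ^ 2 ∂μ := by
  rcases eq_or_ne μ 0 with rfl | hμ
  · simp
  have : NeZero μ := ⟨hμ⟩
  have hpos : 0 < μ.real univ := measureReal_univ_pos
  have jensen : (⨍ t, ‖f t‖ ∂μ) ^ 2 ≤ ⨍ t, ‖f t‖ ^ 2 ∂μ :=
    even_two.convexOn_pow.map_average_le (continuous_pow 2).continuousOn isClosed_univ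
      (by simp) (hf.integrable one_le_two).norm (integrable_norm_sq hf)
  simp only [average_eq, smul_eq_mul, mul_pow] at jensen
  have hnorm := norm_integral_le_integral_norm (μ := μ) f
  calc ‖∫ t, f t ∂μ‖ ^ 2 ≤ (∫ t, ‖f t‖ ∂μ) ^ 2 := by gcongr
    _ = μ.real univ ^ 2 * ((μ.real univ)⁻¹ ^ 2 * (∫ t, ‖f t‖ ∂μ) ^ 2) := by field_simp
    _ ≤ μ.real univ ^ 2 * ((μ.real univ)⁻¹ * ∫ t, ‖f t‖ ^ 2 ∂μ) := by gcongr
    _ = μ.real univ * ∫ t, ‖f t‖ ^ 2 ∂μ := by field_simp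

theorem norm_sq_intervalIntegral_le [NormedSpace ℝ X] {f : ℝ → X} {a b : ℝ} (hab : a ≤ b)
    (hf : MemLp f 2 (volume.restrict (Ioc a b))) :
    ‖∫ t in a..b, f t‖ ^ 2 ≤ (b - a) * ∫ t in a..b, ‖f t‖ ^ 2 := by
  simpa [intervalIntegral.integral_of_le hab, hab] using norm_sq_integral_le hf

variable [InnerProductSpace ℝ X]

theorem integrable_inner {f g : α → X} (hf : MemLp f 2 μ) (hg : MemLp g 2 μ) :
    Integrable (fun t => ⟪f t, g t⟫_ℝ) μ :=
  (hf.norm.integrable_mul hg.norm).mono' (hf.1.inner hg.1)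
    (Eventually.of_forall fun t => norm_inner_le_norm (f t) (g t))

theorem integral_norm_add_sq {f g : α → X} (hf : MemLp f 2 μ) (hg : MemLp g 2 μ) :
    ∫ t, ‖f t + g t‖ ^ 2 ∂μ
      = (∫ t, ‖f t‖ ^ 2 ∂μ) + 2 * (∫ t, ⟪f t, g t⟫_ℝ ∂μ) + ∫ t, ‖g t‖ ^ 2 ∂μ := by
  have hinner := (integrable_inner hf hg).const_mul 2
  simp_rw [norm_add_sq_real]
  rw [integral_add (by exact (integrable_norm_sq hf).add hinner) (integrable_norm_sq hg),
    integral_add (integrable_norm_sq hf) hinner, integral_const_mul]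

end SquareIntegrable

theorem integral_norm_sq_le_of_tendsto_ae {α X : Type*} [MeasurableSpace α] {μ : Measure α}
    [NormedAddCommGroup X] {f : ℕ → α → X} {g : α → X} {K : ℝ} (hf : ∀ n, MemLp (f n) 2 μ)
    (hK : ∀ n, ∫ t, ‖f n t‖ ^ 2 ∂μ ≤ K)
    (hlim : ∀ᵐ t ∂μ, Tendsto (fun n => f n t) atTop (𝓝 (g t))) :
    ∫ t, ‖g t‖ ^ 2 ∂μ ≤ K := by
  have hK₀ : 0 ≤ K := (integral_nonneg fun t => sq_nonneg ‖f 0 t‖).trans (hK 0)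
  have hg : AEStronglyMeasurable g μ :=
    aestronglyMeasurable_of_tendsto_ae _ (fun n => (hf n).1) hlim
  rw [integral_eq_lintegral_of_nonneg_ae (ae_of_all μ fun t => sq_nonneg ‖g t‖) (hg.norm.pow 2)]
  refine ENNReal.toReal_le_of_le_ofReal hK₀ ?_
  calc ∫⁻ t, ENNReal.ofReal (‖g t‖ ^ 2) ∂μ
      = ∫⁻ t, liminf (fun n => ENNReal.ofReal (‖f n t‖ ^ 2)) atTop ∂μ := by
        refine lintegral_congr_ae ?_
        filter_upwards [hlim] with t ht
        exact (ENNReal.tendsto_ofReal (ht.norm.pow 2)).liminf_eq.symm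
    _ ≤ liminf (fun n => ∫⁻ t, ENNReal.ofReal (‖f n t‖ ^ 2) ∂μ) atTop :=
        lintegral_liminf_le' fun n => ((hf n).1.norm.pow 2).aemeasurable.ennreal_ofReal
    _ ≤ ENNReal.ofReal K := by
        refine liminf_le_of_frequently_le' (Frequently.of_forall fun n => ?_)
        rw [← ofReal_integral_eq_lintegral_ofReal (integrable_norm_sq (hf n))
          (ae_of_all μ fun t => sq_nonneg _)]
        exact ENNReal.ofReal_le_ofReal (hK n)

section SteklovMean

variable {X : Type*} [NormedAddCommGroup X]

theorem intervalIntegrable_of_memLp_two {q : ℝ → X} (hq : MemLp q 2 volume) (a b : ℝ) :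
    IntervalIntegrable q volume a b :=
  ⟨(hq.restrict _).integrable one_le_two, (hq.restrict _).integrable one_le_two⟩

section

variable [NormedSpace ℝ X]

/-- The backward Steklov mean `h⁻¹ ∫_{t-h}^t q`, a mollification of `q` which is at the same time
the backward difference quotient of its primitive. -/
def steklovMean (h : ℝ) (q : ℝ → X) (t : ℝ) : X := h⁻¹ • ∫ y in (t - h)..t, q y

theorem steklovMean_eq_convolution {h : ℝ} (hh : 0 ≤ h) (ψ : ℝ → ℝ) :
    steklovMean h ψ = convolution ((Ioc 0 h).indicator fun _ => h⁻¹) ψ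
      (ContinuousLinearMap.mul ℝ ℝ) volume := by
  funext t
  have hind : ∀ r, (ContinuousLinearMap.mul ℝ ℝ) ((Ioc 0 h).indicator (fun _ => h⁻¹) r) (ψ (t - r))
      = (Ioc 0 h).indicator (fun r => h⁻¹ * ψ (t - r)) r := fun r => by
    by_cases hr : r ∈ Ioc 0 h <;> simp [hr]
  simp_rw [convolution_def, hind]
  rw [integral_indicator measurableSet_Ioc, ← intervalIntegral.integral_of_le hh,
    intervalIntegral.integral_const_mul, intervalIntegral.integral_comp_sub_left (fun y => ψ y) t,
    sub_zero, steklovMean, smul_eq_mul]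

theorem integrable_indicator_Ioc_const (a b c : ℝ) :
    Integrable ((Ioc a b).indicator fun _ : ℝ => c) :=
  (integrable_indicator_iff measurableSet_Ioc).2 (integrableOn_const (by simp))

theorem integrable_steklovMean {h : ℝ} (hh : 0 ≤ h) {ψ : ℝ → ℝ} (hψ : Integrable ψ) :
    Integrable (steklovMean h ψ) := by
  rw [steklovMean_eq_convolution hh]
  exact (integrable_indicator_Ioc_const 0 h h⁻¹).integrable_convolution _ hψ

theorem integral_steklovMean {h : ℝ} (hh : 0 < h) {ψ : ℝ → ℝ} (hψ : Integrable ψ) :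
    ∫ t, steklovMean h ψ t = ∫ t, ψ t := by
  rw [steklovMean_eq_convolution hh.le,
    integral_convolution _ (integrable_indicator_Ioc_const 0 h h⁻¹) hψ,
    integral_indicator measurableSet_Ioc]
  simp [hh.le, hh.ne']

theorem norm_sq_steklovMean_le {h : ℝ} (hh : 0 < h) {q : ℝ → X} (hq : MemLp q 2 volume) (t : ℝ) :
    ‖steklovMean h q t‖ ^ 2 ≤ steklovMean h (fun y => ‖q y‖ ^ 2) t := by
  have hint : ‖∫ y in (t - h)..t, q y‖ ^ 2 ≤ h * ∫ y in (t - h)..t, ‖q y‖ ^ 2 := by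
    simpa using norm_sq_intervalIntegral_le (sub_le_self t hh.le) (hq.restrict _)
  calc ‖steklovMean h q t‖ ^ 2 = h⁻¹ ^ 2 * ‖∫ y in (t - h)..t, q y‖ ^ 2 := by
        rw [steklovMean, norm_smul, mul_pow, Real.norm_of_nonneg (inv_nonneg.2 hh.le)]
    _ ≤ h⁻¹ ^ 2 * (h * ∫ y in (t - h)..t, ‖q y‖ ^ 2) := by gcongr
    _ = steklovMean h (fun y => ‖q y‖ ^ 2) t := by rw [steklovMean, smul_eq_mul]; field_simp

theorem continuous_steklovMean {q : ℝ → X} (hq : ∀ a b, IntervalIntegrable q volume a b) (h : ℝ) :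
    Continuous (steklovMean h q) := by
  have hprim := intervalIntegral.continuous_primitive hq 0
  have hdiff : steklovMean h q
      = fun t => h⁻¹ • ((∫ y in (0 : ℝ)..t, q y) - ∫ y in (0 : ℝ)..(t - h), q y) := by
    funext t
    rw [steklovMean, intervalIntegral.integral_interval_sub_left (hq _ _) (hq _ _)]
  rw [hdiff]
  exact (hprim.sub (hprim.comp (continuous_sub_right h))).const_smul _

theorem memLp_steklovMean {h : ℝ} (hh : 0 < h) {q : ℝ → X} (hq : MemLp q 2 volume) :
    MemLp (steklovMean h q) 2 volume := by
  have hcont := continuous_steklovMean (intervalIntegrable_of_memLp_two hq) h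
  rw [memLp_two_iff_integrable_sq_norm hcont.aestronglyMeasurable]
  refine (integrable_steklovMean hh.le (integrable_norm_sq hq)).mono'
    (hcont.norm.pow 2).aestronglyMeasurable (Eventually.of_forall fun t => ?_)
  rw [Real.norm_of_nonneg (sq_nonneg _)]
  exact norm_sq_steklovMean_le hh hq t

theorem integral_norm_sq_steklovMean_le {h : ℝ} (hh : 0 < h) {q : ℝ → X} (hq : MemLp q 2 volume) :
    ∫ t, ‖steklovMean h q t‖ ^ 2 ≤ ∫ t, ‖q t‖ ^ 2 :=
  (integral_mono (integrable_norm_sq (memLp_steklovMean hh hq))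
    (integrable_steklovMean hh.le (integrable_norm_sq hq)) (norm_sq_steklovMean_le hh hq)).trans_eq
    (integral_steklovMean hh (integrable_norm_sq hq))

theorem setIntegral_norm_sq_steklovMean_le {s : Set ℝ} (hs : MeasurableSet s) {q : ℝ → X}
    (hq : MemLp q 2 (volume.restrict s)) {h : ℝ} (hh : 0 < h) :
    ∫ t in s, ‖steklovMean h (s.indicator q) t‖ ^ 2 ≤ ∫ t in s, ‖q t‖ ^ 2 := by
  have hq' : MemLp (s.indicator q) 2 volume := (memLp_indicator_iff_restrict hs).2 hq
  calc ∫ t in s, ‖steklovMean h (s.indicator q) t‖ ^ 2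
      ≤ ∫ t, ‖steklovMean h (s.indicator q) t‖ ^ 2 :=
        setIntegral_le_integral (integrable_norm_sq (memLp_steklovMean hh hq'))
          (ae_of_all _ fun t => sq_nonneg _)
    _ ≤ ∫ t, ‖s.indicator q t‖ ^ 2 := integral_norm_sq_steklovMean_le hh hq'
    _ = ∫ t in s, ‖q t‖ ^ 2 := by
        rw [← integral_indicator hs]
        exact integral_congr_ae (ae_of_all _ fun t => by by_cases ht : t ∈ s <;> simp [ht])

theorem ae_tendsto_steklovMean [CompleteSpace X] {q : ℝ → X} (hq : LocallyIntegrable q volume) :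
    ∀ᵐ t, Tendsto (fun h => steklovMean h q t) (𝓝[>] 0) (𝓝 (q t)) := by
  filter_upwards [LocallyIntegrable.ae_hasDerivAt_integral hq] with t ht
  have hslope := hasDerivAt_iff_tendsto_slope.1 (ht t)
  have hback : Tendsto (fun h => t - h) (𝓝[>] 0) (𝓝[≠] t) := by
    refine tendsto_nhdsWithin_iff.2 ⟨?_, ?_⟩
    · exact tendsto_nhdsWithin_of_tendsto_nhds (by
        simpa using (tendsto_const_nhds (x := t)).sub (tendsto_id (x := 𝓝 (0 : ℝ))))
    · filter_upwards [self_mem_nhdsWithin] with h hh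
      simpa using (mem_Ioi.1 hh).ne'
  refine (hslope.comp hback).congr fun h => ?_
  rw [Function.comp_apply, slope_def_module, intervalIntegral.integral_same, sub_zero,
    intervalIntegral.integral_symm, sub_sub_cancel_left, inv_neg, neg_smul_neg, steklovMean]

end

theorem setIntegral_inner_le_of_steklovMean [InnerProductSpace ℝ X] [CompleteSpace X] {s : Set ℝ}
    (hs : MeasurableSet s) {q g : ℝ → X} {c : ℝ} (hq : MemLp q 2 (volume.restrict s))
    (hg : MemLp g 2 (volume.restrict s))
    (hc : ∀ h : ℝ, 0 < h → ∫ t in s, ⟪g t, steklovMean h (s.indicator q) t⟫_ℝ ≤ c) :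
    ∫ t in s, ⟪g t, q t⟫_ℝ ≤ c := by
  have hq' : MemLp (s.indicator q) 2 volume := (memLp_indicator_iff_restrict hs).2 hq
  have hmean : ∀ h : ℝ, 0 < h → MemLp (steklovMean h (s.indicator q)) 2 (volume.restrict s) :=
    fun h hh => (memLp_steklovMean hh hq').restrict s
  let h : ℕ → ℝ := fun k => 1 / ((k : ℝ) + 1)
  have h_pos : ∀ k, 0 < h k := fun k => Nat.one_div_pos_of_nat
  have h_lim : Tendsto h atTop (𝓝[>] 0) := tendsto_nhdsWithin_iff.2
    ⟨tendsto_one_div_add_atTop_nhds_zero_nat, Eventually.of_forall h_pos⟩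
  -- The means are bounded in `L²` by `q`, so Fatou's lemma for `‖g + mean‖²` gives the claim.
  have fatou : ∫ t in s, ‖g t + q t‖ ^ 2
      ≤ (∫ t in s, ‖g t‖ ^ 2) + 2 * c + ∫ t in s, ‖q t‖ ^ 2 := by
    refine integral_norm_sq_le_of_tendsto_ae
      (f := fun k t => g t + steklovMean (h k) (s.indicator q) t)
      (fun k => hg.add (hmean _ (h_pos k))) (fun k => ?_) ?_
    · rw [integral_norm_add_sq hg (hmean _ (h_pos k))]
      linarith [hc _ (h_pos k), setIntegral_norm_sq_steklovMean_le hs hq (h_pos k)]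
    · filter_upwards [ae_restrict_of_ae (ae_tendsto_steklovMean (hq'.locallyIntegrable one_le_two)),
        ae_restrict_mem hs] with t ht hts
      simpa [hts] using (tendsto_const_nhds (x := g t)).add (ht.comp h_lim)
  rw [integral_norm_add_sq hg hq] at fatou
  linarith

end SteklovMean

theorem real_inner_le_young {X : Type*} [NormedAddCommGroup X] [InnerProductSpace ℝ X] {ε : ℝ}
    (hε : 0 < ε) (x y : X) : ⟪x, y⟫_ℝ ≤ ‖x‖ ^ 2 / (2 * ε) + ε / 2 * ‖y‖ ^ 2 := by
  have hsq : 0 ≤ (‖x‖ - ε * ‖y‖) ^ 2 / (2 * ε) := by positivity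
  have hexpand : (‖x‖ - ε * ‖y‖) ^ 2 / (2 * ε)
      = ‖x‖ ^ 2 / (2 * ε) + ε / 2 * ‖y‖ ^ 2 - ‖x‖ * ‖y‖ := by
    field_simp
    ring
  linarith [real_inner_le_norm x y]

theorem sum_Icc_sub_pred {M : Type*} [AddCommGroup M] (f : ℕ → M) (m : ℕ) :
    ∑ n ∈ Finset.Icc 1 m, (f n - f (n - 1)) = f m - f 0 := by
  induction m with
  | zero => simp
  | succ m ih =>
    rw [Finset.sum_Icc_succ_top (by omega), ih, Nat.add_sub_cancel]
    abel

section ExtendPast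

variable {Z : Type*}

/-- The history `f` on `(0, ∞)`, preceded by the constant past `z₀`. -/
def extendPast (z₀ : Z) (f : ℝ → Z) (t : ℝ) : Z := if 0 < t then f t else z₀

theorem extendPast_of_pos (z₀ : Z) (f : ℝ → Z) {t : ℝ} (ht : 0 < t) : extendPast z₀ f t = f t :=
  if_pos ht

theorem extendPast_of_nonpos (z₀ : Z) (f : ℝ → Z) {t : ℝ} (ht : t ≤ 0) : extendPast z₀ f t = z₀ :=
  if_neg ht.not_gt

theorem integrableOn_extendPast {c : ℝ} {w : ℝ → ℝ} {T : ℝ} (hw : IntegrableOn w (Ioc 0 T))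
    {a b : ℝ} (hb : b ≤ T) : IntegrableOn (extendPast c w) (Ioc a b) := by
  have hpast : IntegrableOn (extendPast c w) (Ioc a 0) :=
    (integrableOn_const (C := c) (by simp)).congr_fun
      (fun t ht => (extendPast_of_nonpos c w ht.2).symm) measurableSet_Ioc
  have hfuture : IntegrableOn (extendPast c w) (Ioc 0 T) :=
    hw.congr_fun (fun t ht => (extendPast_of_pos c w ht.1).symm) measurableSet_Ioc
  exact (hpast.union hfuture).mono_set fun t ht =>
    (le_or_gt t 0).imp (⟨ht.1, ·⟩) (⟨·, ht.2.trans hb⟩)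

theorem intervalIntegrable_extendPast {c : ℝ} {w : ℝ → ℝ} {T : ℝ} (hw : IntegrableOn w (Ioc 0 T))
    {a b : ℝ} (ha : a ≤ T) (hb : b ≤ T) : IntervalIntegrable (extendPast c w) volume a b :=
  ⟨integrableOn_extendPast hw hb, integrableOn_extendPast hw ha⟩

theorem intervalIntegrable_extendPast_shift {c : ℝ} {w : ℝ → ℝ} {T : ℝ} (hT : 0 ≤ T)
    (hw : IntegrableOn w (Ioc 0 T)) {h : ℝ} (hh : 0 ≤ h) :
    IntervalIntegrable (fun t => extendPast c w (t - h)) volume 0 T := by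
  simpa using (intervalIntegrable_extendPast (c := c) hw (a := 0 - h) (b := T - h) (by linarith)
    (by linarith)).comp_sub_right h

theorem integral_extendPast_shift_sub_le {c : ℝ} {w : ℝ → ℝ} {T : ℝ} (hT : 0 ≤ T)
    (hw : IntegrableOn w (Ioc 0 T)) (hc : 0 ≤ c) (hw₀ : ∀ t, 0 ≤ w t) {h : ℝ} (hh : 0 ≤ h) :
    ∫ t in (0 : ℝ)..T, (extendPast c w (t - h) - extendPast c w t) ≤ h * c := by
  have hint : ∀ {a b : ℝ}, a ≤ T → b ≤ T → IntervalIntegrable (extendPast c w) volume a b :=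
    intervalIntegrable_extendPast hw
  have hpast : ∫ t in (-h)..0, extendPast c w t = h * c := by
    rw [intervalIntegral.integral_congr_uIoo (g := fun _ => c)]
    · simp
    · intro t ht
      exact extendPast_of_nonpos c w (by rw [uIoo_of_le (by linarith)] at ht; exact ht.2.le)
  have hlast : 0 ≤ ∫ t in (T - h)..T, extendPast c w t :=
    intervalIntegral.integral_nonneg (by linarith) fun t _ => by
      unfold extendPast
      split_ifs
      exacts [hw₀ t, hc]
  calc ∫ t in (0 : ℝ)..T, (extendPast c w (t - h) - extendPast c w t)
      = (∫ t in (-h)..0, extendPast c w t) - ∫ t in (T - h)..T, extendPast c w t := by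
        rw [intervalIntegral.integral_sub (intervalIntegrable_extendPast_shift hT hw hh)
            (hint hT le_rfl), intervalIntegral.integral_comp_sub_right _ h, zero_sub,
          intervalIntegral.integral_interval_sub_interval_comm (hint (by linarith) (by linarith))
            (hint hT le_rfl) (hint (by linarith) hT)]
    _ ≤ h * c := by linarith

end ExtendPast

section Energy

variable {Y : Type*} [NormedAddCommGroup Y] [InnerProductSpace ℝ Y]

/-- An abstract saturation map: `S` is a selection of subgradients of the convex potential `Φ`,
bounded by `B` and cocoercive with constant `L`. -/
structure IsSaturationMap (S : Y → Y) (Φ : Y → ℝ) (L B : ℝ) : Prop where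
  pos : 0 < L
  subgradient : ∀ x y, ⟪x - y, S y⟫_ℝ ≤ Φ x - Φ y
  norm_le : ∀ x, ‖S x‖ ≤ B
  cocoercive : ∀ x y, ‖S x - S y‖ ^ 2 ≤ L * ⟪S x - S y, x - y⟫_ℝ

/-- The Legendre-type energy `⟪x, S x⟫ - (Φ x - Φ 0)`, which the flow dissipates. -/
def energy (S : Y → Y) (Φ : Y → ℝ) (x : Y) : ℝ := ⟪x, S x⟫_ℝ - (Φ x - Φ 0)

namespace IsSaturationMap

variable {S : Y → Y} {Φ : Y → ℝ} {L B : ℝ}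

theorem energy_nonneg (hS : IsSaturationMap S Φ L B) (x : Y) : 0 ≤ energy S Φ x := by
  have hsub := hS.subgradient 0 x
  rw [zero_sub, inner_neg_left] at hsub
  unfold energy
  linarith

theorem energy_sub_le (hS : IsSaturationMap S Φ L B) (x y : Y) :
    energy S Φ x - energy S Φ y ≤ ⟪x, S x - S y⟫_ℝ := by
  have hsub := hS.subgradient x y
  rw [inner_sub_left] at hsub
  unfold energy
  rw [inner_sub_right]
  linarith

theorem energy_le (hS : IsSaturationMap S Φ L B) (x : Y) : energy S Φ x ≤ 2 * B * ‖x‖ := by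
  have hzero : energy S Φ 0 = 0 := by simp [energy]
  calc energy S Φ x = energy S Φ x - energy S Φ 0 := by rw [hzero, sub_zero]
    _ ≤ ⟪x, S x - S 0⟫_ℝ := hS.energy_sub_le x 0
    _ ≤ ‖x‖ * ‖S x - S 0‖ := real_inner_le_norm _ _
    _ ≤ ‖x‖ * (B + B) := by
        gcongr
        exact (norm_sub_le _ _).trans (add_le_add (hS.norm_le x) (hS.norm_le 0))
    _ = 2 * B * ‖x‖ := by ring

theorem continuous (hS : IsSaturationMap S Φ L B) : Continuous S := by
  refine (LipschitzWith.of_dist_le' (K := L) fun x y => ?_).continuous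
  rw [dist_eq_norm, dist_eq_norm]
  have hsq : ‖S x - S y‖ * ‖S x - S y‖ ≤ ‖S x - S y‖ * (L * ‖x - y‖) := by
    calc ‖S x - S y‖ * ‖S x - S y‖ ≤ L * ⟪S x - S y, x - y⟫_ℝ := by
          simpa [sq] using hS.cocoercive x y
      _ ≤ L * (‖S x - S y‖ * ‖x - y‖) :=
          mul_le_mul_of_nonneg_left (real_inner_le_norm _ _) hS.pos.le
      _ = ‖S x - S y‖ * (L * ‖x - y‖) := by ring
  rcases (norm_nonneg (S x - S y)).eq_or_lt with hzero | hpos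
  · rw [← hzero]
    exact mul_nonneg hS.pos.le (norm_nonneg _)
  · exact le_of_mul_le_mul_left hsq hpos

theorem continuous_potential (hS : IsSaturationMap S Φ L B) : Continuous Φ := by
  have hsub : ∀ x y, Φ x - Φ y ≤ B * dist x y := fun x y =>
    calc Φ x - Φ y ≤ ⟪x - y, S x⟫_ℝ := by
          have := hS.subgradient y x
          rw [← neg_sub x y, inner_neg_left] at this
          linarith
      _ ≤ ‖x - y‖ * ‖S x‖ := real_inner_le_norm _ _
      _ ≤ B * dist x y := by
          rw [dist_eq_norm, mul_comm]
          gcongr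
          exact hS.norm_le x
  exact (LipschitzWith.of_le_add_mul' B fun x y => by linarith [hsub x y]).continuous

theorem continuous_energy (hS : IsSaturationMap S Φ L B) : Continuous (energy S Φ) :=
  (continuous_id.inner hS.continuous).sub (hS.continuous_potential.sub continuous_const)

theorem integrable_energy (hS : IsSaturationMap S Φ L B) {α : Type*} [MeasurableSpace α]
    {μ : Measure α} {Θ : α → Y} (hΘ : Integrable Θ μ) :
    Integrable (fun t => energy S Φ (Θ t)) μ := by
  refine (hΘ.norm.const_mul (2 * B)).mono' (hS.continuous_energy.comp_aestronglyMeasurable hΘ.1)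
    (Eventually.of_forall fun t => ?_)
  rw [Real.norm_of_nonneg (hS.energy_nonneg _)]
  exact hS.energy_le _

end IsSaturationMap

end Energy

theorem ae_hasDerivAt_intervalIntegral {Z : Type*} [NormedAddCommGroup Z] [NormedSpace ℝ Z]
    [CompleteSpace Z] {f : ℝ → Z} {a b : ℝ} (hf : IntegrableOn f (Ioc a b)) :
    ∀ᵐ t, t ∈ Ioc a b → HasDerivAt (fun r => ∫ y in a..r, f y) (f t) t := by
  rcases le_or_gt b a with hab | hab
  · simp [Ioc_eq_empty_of_le hab]
  filter_upwards [((intervalIntegrable_iff_integrableOn_Ioc_of_le hab.le).2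
    hf).ae_hasDerivAt_integral] with t ht htab
  rw [uIcc_of_le hab.le] at ht
  exact ht (Ioc_subset_Icc_self htab) a (left_mem_Icc.2 hab.le)

section Flow

variable {X Y V : Type*} [NormedAddCommGroup X] [InnerProductSpace ℝ X]
  [NormedAddCommGroup Y] [InnerProductSpace ℝ Y] [AddCommGroup V] [Module ℝ V]

/-- The integrated evolution `∂ₜ S(Θ) + δ q = 0`, `⟪q - F, φ v⟫ = ⟪Θ, δ v⟫` on `(0, T]` in abstract
form: `φ` is the inclusion of the flux space `V` into `X`, `δ` the divergence, `Q` the primitive of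
the flux `q` and `F` the lower order part of the flux, bounded by `Bf`. -/
structure IsFlow (φ : V →ₗ[ℝ] X) (δ : V →ₗ[ℝ] Y) (S : Y → Y) (T : ℝ) (ΘI : Y) (Bf : ℝ)
    (Θ : ℝ → Y) (q F : ℝ → X) (Q : ℝ → V) : Prop where
  memLp_Θ : MemLp Θ 2 (volume.restrict (Ioc 0 T))
  memLp_q : MemLp q 2 (volume.restrict (Ioc 0 T))
  aestronglyMeasurable_F : AEStronglyMeasurable F (volume.restrict (Ioc 0 T))
  norm_F_le : ∀ᵐ t ∂(volume.restrict (Ioc 0 T)), ‖F t‖ ≤ Bf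
  primitive : ∀ t ∈ Ioc 0 T, φ (Q t) = ∫ y in (0 : ℝ)..t, q y
  mass : ∀ t ∈ Ioc 0 T, S (Θ t) - S ΘI + δ (Q t) = 0
  flux : ∀ t ∈ Ioc 0 T, ∀ v, ⟪∫ y in (0 : ℝ)..t, q y, φ v⟫_ℝ - ⟪∫ y in (0 : ℝ)..t, Θ y, δ v⟫_ℝ
    = ⟪∫ y in (0 : ℝ)..t, F y, φ v⟫_ℝ

/-- The implicit Euler discretization of the evolution in `IsFlow`, with `N` steps of size `τ`. -/
structure IsEulerFlow (φ : V →ₗ[ℝ] X) (δ : V →ₗ[ℝ] Y) (S : Y → Y) (τ : ℝ) (N : ℕ) (ΘI : Y)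
    (Bf : ℝ) (Θ : ℕ → Y) (q : ℕ → V) (F : ℕ → X) : Prop where
  initial : Θ 0 = ΘI
  norm_F_le : ∀ n ∈ Finset.Icc 1 N, ‖F n‖ ≤ Bf
  mass : ∀ n ∈ Finset.Icc 1 N, S (Θ n) - S (Θ (n - 1)) + τ • δ (q n) = 0
  flux : ∀ n ∈ Finset.Icc 1 N, ∀ v, ⟪φ (q n), φ v⟫_ℝ - ⟪Θ n, δ v⟫_ℝ = ⟪F n, φ v⟫_ℝ

variable {φ : V →ₗ[ℝ] X} {δ : V →ₗ[ℝ] Y} {S : Y → Y} {Φ : Y → ℝ} {L B T : ℝ} {ΘI : Y} {Bf : ℝ}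

namespace IsFlow

variable {Θ : ℝ → Y} {q F : ℝ → X} {Q : ℝ → V}

theorem memLp_F (h : IsFlow φ δ S T ΘI Bf Θ q F Q) : MemLp F 2 (volume.restrict (Ioc 0 T)) :=
  MemLp.of_bound h.aestronglyMeasurable_F Bf h.norm_F_le

theorem memLp_indicator_q (h : IsFlow φ δ S T ΘI Bf Θ q F Q) :
    MemLp ((Ioc 0 T).indicator q) 2 volume :=
  (memLp_indicator_iff_restrict measurableSet_Ioc).2 h.memLp_q

theorem ae_flux [CompleteSpace X] [CompleteSpace Y] (h : IsFlow φ δ S T ΘI Bf Θ q F Q) :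
    ∀ᵐ t ∂(volume.restrict (Ioc 0 T)), ∀ v, ⟪q t - F t, φ v⟫_ℝ = ⟪Θ t, δ v⟫_ℝ := by
  have hne : ∀ᵐ t : ℝ, t ≠ T := by simp [ae_iff]
  rw [ae_restrict_iff' measurableSet_Ioc]
  filter_upwards [ae_hasDerivAt_intervalIntegral (h.memLp_q.integrable one_le_two),
    ae_hasDerivAt_intervalIntegral (h.memLp_Θ.integrable one_le_two),
    ae_hasDerivAt_intervalIntegral (h.memLp_F.integrable one_le_two), hne] with t hq hΘ hF htT ht v
  have hlhs := ((hq ht).inner ℝ (hasDerivAt_const t (φ v))).sub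
    ((hΘ ht).inner ℝ (hasDerivAt_const t (δ v)))
  have hrhs := (hF ht).inner ℝ (hasDerivAt_const t (φ v))
  have hflux : (fun r => ⟪∫ y in (0 : ℝ)..r, q y, φ v⟫_ℝ - ⟪∫ y in (0 : ℝ)..r, Θ y, δ v⟫_ℝ)
      =ᶠ[𝓝 t] fun r => ⟪∫ y in (0 : ℝ)..r, F y, φ v⟫_ℝ := by
    filter_upwards [Ioo_mem_nhds ht.1 (ht.2.lt_of_ne htT)] with r hr
    exact h.flux r (Ioo_subset_Ioc_self hr) v
  have heq := (hlhs.congr_of_eventuallyEq hflux.symm).unique hrhs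
  simp only [inner_zero_right, zero_add] at heq
  rw [inner_sub_left]
  linarith

theorem intervalIntegral_indicator_q (h : IsFlow φ δ S T ΘI Bf Θ q F Q) {a : ℝ} (ha : a ≤ T) :
    ∫ y in (0 : ℝ)..a, (Ioc 0 T).indicator q y = φ (extendPast 0 Q a) := by
  rcases le_or_gt a 0 with hneg | hpos
  · rw [extendPast_of_nonpos _ _ hneg, map_zero]
    refine intervalIntegral.integral_zero_ae (ae_of_all _ fun y hy => ?_)
    rw [uIoc_of_ge hneg] at hy
    exact indicator_of_notMem (fun hy' => hy.2.not_gt hy'.1) q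
  · rw [extendPast_of_pos _ _ hpos, h.primitive a ⟨hpos, ha⟩]
    refine intervalIntegral.integral_congr_ae (ae_of_all _ fun y hy => ?_)
    rw [uIoc_of_le hpos.le] at hy
    exact indicator_of_mem (show y ∈ Ioc 0 T from ⟨hy.1, hy.2.trans ha⟩) q

theorem map_extendPast_Q (h : IsFlow φ δ S T ΘI Bf Θ q F Q) {a : ℝ} (ha : a ≤ T) :
    δ (extendPast 0 Q a) = S ΘI - S (extendPast ΘI Θ a) := by
  rcases le_or_gt a 0 with hneg | hpos
  · simp [extendPast_of_nonpos _ _ hneg]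
  · rw [extendPast_of_pos _ _ hpos, extendPast_of_pos _ _ hpos,
      eq_neg_of_add_eq_zero_right (h.mass a ⟨hpos, ha⟩), neg_sub]

theorem steklovMean_indicator_q (h : IsFlow φ δ S T ΘI Bf Θ q F Q) {e t : ℝ} (he : 0 ≤ e)
    (ht : t ≤ T) : steklovMean e ((Ioc 0 T).indicator q) t
      = φ (e⁻¹ • (extendPast 0 Q t - extendPast 0 Q (t - e))) := by
  have hint := intervalIntegrable_of_memLp_two h.memLp_indicator_q
  rw [steklovMean, map_smul, map_sub, ← h.intervalIntegral_indicator_q ht,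
    ← h.intervalIntegral_indicator_q (a := t - e) (by linarith),
    intervalIntegral.integral_interval_sub_left (hint _ _) (hint _ _)]

theorem ae_inner_steklovMean_le [CompleteSpace X] [CompleteSpace Y]
    (h : IsFlow φ δ S T ΘI Bf Θ q F Q) (hS : IsSaturationMap S Φ L B) {e : ℝ} (he : 0 ≤ e) :
    ∀ᵐ t ∂(volume.restrict (Ioc 0 T)),
      ⟪q t - F t, steklovMean e ((Ioc 0 T).indicator q) t⟫_ℝ
        ≤ e⁻¹ * (extendPast (energy S Φ ΘI) (fun r => energy S Φ (Θ r)) (t - e)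
          - extendPast (energy S Φ ΘI) (fun r => energy S Φ (Θ r)) t) := by
  have hcomp : ∀ r, extendPast (energy S Φ ΘI) (fun r => energy S Φ (Θ r)) r
      = energy S Φ (extendPast ΘI Θ r) := fun r => (apply_ite (energy S Φ) _ _ _).symm
  filter_upwards [h.ae_flux, ae_restrict_mem measurableSet_Ioc] with t hflux ht
  have hΘ : Θ t = extendPast ΘI Θ t := (extendPast_of_pos ΘI Θ ht.1).symm
  have hincr : δ (extendPast 0 Q t - extendPast 0 Q (t - e))
      = -(S (extendPast ΘI Θ t) - S (extendPast ΘI Θ (t - e))) := by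
    rw [map_sub, h.map_extendPast_Q ht.2, h.map_extendPast_Q (by linarith [ht.2])]
    abel
  rw [h.steklovMean_indicator_q he ht.2, hflux, hΘ, map_smul, real_inner_smul_right, hincr,
    inner_neg_right, hcomp, hcomp]
  gcongr
  linarith [hS.energy_sub_le (extendPast ΘI Θ t) (extendPast ΘI Θ (t - e))]

theorem integral_inner_flux_le [CompleteSpace X] [CompleteSpace Y] (hT : 0 ≤ T)
    (h : IsFlow φ δ S T ΘI Bf Θ q F Q) (hS : IsSaturationMap S Φ L B) :
    ∫ t in Ioc 0 T, ⟪q t - F t, q t⟫_ℝ ≤ energy S Φ ΘI := by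
  have hqF : MemLp (fun t => q t - F t) 2 (volume.restrict (Ioc 0 T)) := h.memLp_q.sub h.memLp_F
  have hw : IntegrableOn (fun t => energy S Φ (Θ t)) (Ioc 0 T) :=
    hS.integrable_energy (h.memLp_Θ.integrable one_le_two)
  refine setIntegral_inner_le_of_steklovMean measurableSet_Ioc h.memLp_q hqF fun e he => ?_
  let E := extendPast (energy S Φ ΘI) fun r => energy S Φ (Θ r)
  calc ∫ t in Ioc 0 T, ⟪q t - F t, steklovMean e ((Ioc 0 T).indicator q) t⟫_ℝ
      ≤ ∫ t in Ioc 0 T, e⁻¹ * (E (t - e) - E t) := by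
        refine integral_mono_ae
          (integrable_inner hqF ((memLp_steklovMean he h.memLp_indicator_q).restrict _)) ?_
          (h.ae_inner_steklovMean_le hS he.le)
        exact (Integrable.sub (intervalIntegrable_extendPast_shift hT hw he.le).1
          (intervalIntegrable_extendPast hw hT le_rfl).1).const_mul _
    _ = e⁻¹ * ∫ t in (0 : ℝ)..T, (E (t - e) - E t) := by
        rw [integral_const_mul, intervalIntegral.integral_of_le hT]
    _ ≤ e⁻¹ * (e * energy S Φ ΘI) := by
        gcongr
        exact integral_extendPast_shift_sub_le hT hw (hS.energy_nonneg _)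
          (fun t => hS.energy_nonneg _) he.le
    _ = energy S Φ ΘI := by field_simp

theorem integral_norm_sq_le [CompleteSpace X] [CompleteSpace Y] (hT : 0 ≤ T)
    (h : IsFlow φ δ S T ΘI Bf Θ q F Q) (hS : IsSaturationMap S Φ L B) :
    ∫ t in Ioc 0 T, ‖q t‖ ^ 2 ≤ 2 * energy S Φ ΘI + Bf ^ 2 * T := by
  have hq := (integrable_norm_sq h.memLp_q).div_const 2
  have hyoung : ∫ t in Ioc 0 T, (‖q t‖ ^ 2 / 2 - Bf ^ 2 / 2)
      ≤ ∫ t in Ioc 0 T, ⟪q t - F t, q t⟫_ℝ := by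
    refine integral_mono_ae (hq.sub (integrable_const _))
      (integrable_inner (h.memLp_q.sub h.memLp_F) h.memLp_q) ?_
    filter_upwards [h.norm_F_le] with t ht
    have hF := pow_le_pow_left₀ (norm_nonneg _) ht 2
    rw [inner_sub_left, real_inner_self_eq_norm_sq]
    linarith [real_inner_le_young one_pos (F t) (q t)]
  rw [integral_sub hq (integrable_const _), integral_div, setIntegral_const,
    Real.volume_real_Ioc_of_le hT, smul_eq_mul] at hyoung
  linarith [h.integral_inner_flux_le hT hS]

end IsFlow

namespace IsEulerFlow

variable {τ : ℝ} {N : ℕ} {Θ : ℕ → Y} {q : ℕ → V} {F : ℕ → X}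

theorem norm_sq_le_energy_sub (hτ : 0 ≤ τ) (h : IsEulerFlow φ δ S τ N ΘI Bf Θ q F)
    (hS : IsSaturationMap S Φ L B) {n : ℕ} (hn : n ∈ Finset.Icc 1 N) :
    τ * ‖φ (q n)‖ ^ 2 ≤ 2 * (energy S Φ (Θ (n - 1)) - energy S Φ (Θ n)) + Bf ^ 2 * τ := by
  have hflux := h.flux n hn (q n)
  have hmass : τ * ⟪Θ n, δ (q n)⟫_ℝ = -⟪Θ n, S (Θ n) - S (Θ (n - 1))⟫_ℝ := by
    rw [← real_inner_smul_right, eq_neg_of_add_eq_zero_right (h.mass n hn), inner_neg_right]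
  have henergy := hS.energy_sub_le (Θ n) (Θ (n - 1))
  have hF := pow_le_pow_left₀ (norm_nonneg _) (h.norm_F_le n hn) 2
  have hyoung : τ * ⟪F n, φ (q n)⟫_ℝ ≤ τ * (Bf ^ 2 / 2 + ‖φ (q n)‖ ^ 2 / 2) := by
    gcongr
    linarith [real_inner_le_young one_pos (F n) (φ (q n))]
  rw [real_inner_self_eq_norm_sq] at hflux
  linear_combination 2 * (henergy + hyoung + τ * hflux + hmass)

theorem sum_norm_sq_le (hτ : 0 ≤ τ) (h : IsEulerFlow φ δ S τ N ΘI Bf Θ q F)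
    (hS : IsSaturationMap S Φ L B) :
    ∑ n ∈ Finset.Icc 1 N, τ * ‖φ (q n)‖ ^ 2 ≤ 2 * energy S Φ ΘI + Bf ^ 2 * (N * τ) := by
  calc ∑ n ∈ Finset.Icc 1 N, τ * ‖φ (q n)‖ ^ 2
      ≤ ∑ n ∈ Finset.Icc 1 N,
          (-2 * (energy S Φ (Θ n) - energy S Φ (Θ (n - 1))) + Bf ^ 2 * τ) :=
        Finset.sum_le_sum fun n hn => by linarith [h.norm_sq_le_energy_sub hτ hS hn]
    _ = -2 * (energy S Φ (Θ N) - energy S Φ ΘI) + Bf ^ 2 * (N * τ) := by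
        rw [Finset.sum_add_distrib, ← Finset.mul_sum, sum_Icc_sub_pred (fun n => energy S Φ (Θ n)),
          h.initial, Finset.sum_const, Nat.card_Icc, Nat.add_sub_cancel, nsmul_eq_mul]
        ring
    _ ≤ 2 * energy S Φ ΘI + Bf ^ 2 * (N * τ) := by linarith [hS.energy_nonneg (Θ N)]

end IsEulerFlow

end Flow

section Gronwall

variable {x y r : ℕ → ℝ} {β R : ℝ} {N : ℕ}

theorem le_exp_mul_sum_of_sub_pred_le (hx₀ : x 0 = 0) (hx : ∀ n, 0 ≤ x n) (hr : ∀ n, 0 ≤ r n)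
    (hβ₀ : 0 ≤ β) (hβ : β ≤ 1 / 2)
    (hrec : ∀ n ∈ Finset.Icc 1 N, x n - x (n - 1) ≤ β * x n + r n) :
    ∀ m ≤ N, x m ≤ Real.exp (2 * (m * β)) * ∑ n ∈ Finset.Icc 1 m, r n := by
  intro m
  induction m with
  | zero => simp [hx₀]
  | succ m ih =>
    intro hm
    have hstep := hrec (m + 1) (Finset.mem_Icc.2 ⟨by omega, hm⟩)
    rw [Nat.add_sub_cancel] at hstep
    have hexp : 1 + 2 * β ≤ Real.exp (2 * β) := by linarith [Real.add_one_le_exp (2 * β)]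
    have hone : 1 ≤ Real.exp (2 * (m * β)) := Real.one_le_exp (by positivity)
    have hinverse : 1 ≤ (1 + 2 * β) * (1 - β) := by nlinarith
    rw [Finset.sum_Icc_succ_top (by omega)]
    calc x (m + 1) ≤ (1 + 2 * β) * (1 - β) * x (m + 1) := le_mul_of_one_le_left (hx _) hinverse
      _ ≤ (1 + 2 * β) * (x m + r (m + 1)) := by
          rw [mul_assoc]
          gcongr
          linarith
      _ ≤ Real.exp (2 * β) * (Real.exp (2 * (m * β)) * (∑ n ∈ Finset.Icc 1 m, r n)
            + Real.exp (2 * (m * β)) * r (m + 1)) := by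
          have := hr (m + 1)
          have := hx m
          gcongr
          · exact ih (by omega)
          · exact le_mul_of_one_le_left (hr _) hone
      _ = Real.exp (2 * ((m + 1 : ℕ) * β)) * (∑ n ∈ Finset.Icc 1 m, r n + r (m + 1)) := by
          rw [← mul_add, ← mul_assoc, ← Real.exp_add]
          congr 2
          push_cast
          ring

theorem add_sum_le_of_sub_pred_add_le (hx₀ : x 0 = 0) (hx : ∀ n, 0 ≤ x n) (hy : ∀ n, 0 ≤ y n)
    (hr : ∀ n, 0 ≤ r n) (hβ₀ : 0 ≤ β) (hβ : β ≤ 1 / 2) (hR : ∑ n ∈ Finset.Icc 1 N, r n ≤ R)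
    (hrec : ∀ n ∈ Finset.Icc 1 N, x n - x (n - 1) + y n ≤ β * x n + r n) :
    x N + ∑ n ∈ Finset.Icc 1 N, y n ≤ R * (1 + N * β * Real.exp (2 * (N * β))) := by
  have hbound : ∀ n ∈ Finset.Icc 1 N, x n ≤ Real.exp (2 * (N * β)) * R := by
    intro n hn
    have hnN := (Finset.mem_Icc.1 hn).2
    calc x n ≤ Real.exp (2 * (n * β)) * ∑ i ∈ Finset.Icc 1 n, r i :=
          le_exp_mul_sum_of_sub_pred_le hx₀ hx hr hβ₀ hβ
            (fun i hi => by linarith [hrec i hi, hy i]) n hnN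
      _ ≤ Real.exp (2 * (N * β)) * R := by
          have hsum : ∑ i ∈ Finset.Icc 1 n, r i ≤ R :=
            (Finset.sum_le_sum_of_subset_of_nonneg (Finset.Icc_subset_Icc_right hnN)
              fun i _ _ => hr i).trans hR
          have := Finset.sum_nonneg fun i (_ : i ∈ Finset.Icc 1 n) => hr i
          gcongr
  have hsum := Finset.sum_le_sum hrec
  rw [Finset.sum_add_distrib, sum_Icc_sub_pred, hx₀, sub_zero, Finset.sum_add_distrib,
    ← Finset.mul_sum] at hsum
  have hsum_x : ∑ n ∈ Finset.Icc 1 N, x n ≤ N * (Real.exp (2 * (N * β)) * R) := by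
    simpa using Finset.sum_le_card_nsmul _ _ _ hbound
  linear_combination hsum + hR + β * hsum_x

end Gronwall

section UniformPartition

theorem timePoint_zero (τ : ℝ) : timePoint τ 0 = 0 := by simp [timePoint]

theorem timePoint_mono {τ : ℝ} (hτ : 0 ≤ τ) : Monotone (timePoint τ) := fun m n hmn => by
  unfold timePoint
  gcongr

theorem timePoint_nonneg {τ : ℝ} (hτ : 0 ≤ τ) (n : ℕ) : 0 ≤ timePoint τ n := by
  unfold timePoint
  positivity

theorem timePoint_sub_pred (τ : ℝ) {n : ℕ} (hn : 1 ≤ n) :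
    timePoint τ n - timePoint τ (n - 1) = τ := by
  unfold timePoint
  rw [Nat.cast_sub hn]
  push_cast
  ring

theorem timePoint_pred_le {τ : ℝ} (hτ : 0 ≤ τ) (n : ℕ) : timePoint τ (n - 1) ≤ timePoint τ n :=
  timePoint_mono hτ (Nat.sub_le n 1)

theorem Ioc_timePoint_subset {τ T : ℝ} (hτ : 0 ≤ τ) {n : ℕ} (hn : timePoint τ n ≤ T) :
    Ioc (timePoint τ (n - 1)) (timePoint τ n) ⊆ Ioc 0 T :=
  Ioc_subset_Ioc (timePoint_nonneg hτ _) hn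

variable {E : Type*} [NormedAddCommGroup E]

theorem intervalIntegrable_of_Ioc_subset {f : ℝ → E} {a b : ℝ} {s : Set ℝ} (hf : IntegrableOn f s)
    (hab : a ≤ b) (hs : Ioc a b ⊆ s) : IntervalIntegrable f volume a b :=
  (intervalIntegrable_iff_integrableOn_Ioc_of_le hab).2 (hf.mono_set hs)

variable [NormedSpace ℝ E]

/-- The integral of `f` over the `n`-th time step. -/
def stepIntegral (τ : ℝ) (f : ℝ → E) (n : ℕ) : E :=
  ∫ t in timePoint τ (n - 1)..timePoint τ n, f t

theorem stepIntegral_eq_setIntegral {τ : ℝ} (hτ : 0 ≤ τ) (f : ℝ → E) (n : ℕ) :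
    stepIntegral τ f n = ∫ t in Ioc (timePoint τ (n - 1)) (timePoint τ n), f t :=
  intervalIntegral.integral_of_le (timePoint_pred_le hτ n)

theorem stepIntegral_nonneg {τ : ℝ} (hτ : 0 ≤ τ) {f : ℝ → ℝ} (hf : ∀ t, 0 ≤ f t) (n : ℕ) :
    0 ≤ stepIntegral τ f n :=
  intervalIntegral.integral_nonneg (timePoint_pred_le hτ n) fun t _ => hf t

theorem sum_stepIntegral {τ T : ℝ} (hτ : 0 ≤ τ) {f : ℝ → E} (hf : IntegrableOn f (Ioc 0 T))
    {m : ℕ} (hm : timePoint τ m ≤ T) :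
    ∑ n ∈ Finset.Icc 1 m, stepIntegral τ f n = ∫ t in (0 : ℝ)..timePoint τ m, f t := by
  have hint : ∀ n ≤ m, IntervalIntegrable f volume 0 (timePoint τ n) := fun n hn =>
    intervalIntegrable_of_Ioc_subset hf (timePoint_nonneg hτ n)
      (Ioc_subset_Ioc_right ((timePoint_mono hτ hn).trans hm))
  have htelescope := sum_Icc_sub_pred (fun n => ∫ t in (0 : ℝ)..timePoint τ n, f t) m
  rw [timePoint_zero, intervalIntegral.integral_same, sub_zero] at htelescope
  rw [← htelescope]
  refine Finset.sum_congr rfl fun n hn => ?_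
  have hnm := (Finset.mem_Icc.1 hn).2
  exact (intervalIntegral.integral_interval_sub_left (hint n hnm)
    (hint (n - 1) ((Nat.sub_le n 1).trans hnm))).symm

theorem stepIntegral_sub_const [CompleteSpace E] {τ T : ℝ} (hτ : 0 ≤ τ) {f : ℝ → E}
    (hf : IntegrableOn f (Ioc 0 T)) {n : ℕ} (hn : 1 ≤ n) (hnT : timePoint τ n ≤ T) (c : E) :
    stepIntegral τ (fun t => f t - c) n = stepIntegral τ f n - τ • c := by
  rw [stepIntegral, intervalIntegral.integral_sub (intervalIntegrable_of_Ioc_subset hf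
    (timePoint_pred_le hτ n) (Ioc_timePoint_subset hτ hnT)) intervalIntegrable_const,
    intervalIntegral.integral_const, timePoint_sub_pred τ hn, stepIntegral]

theorem norm_sq_stepIntegral_le {τ : ℝ} (hτ : 0 ≤ τ) {f : ℝ → E} {n : ℕ} (hn : 1 ≤ n)
    (hf : MemLp f 2 (volume.restrict (Ioc (timePoint τ (n - 1)) (timePoint τ n)))) :
    ‖stepIntegral τ f n‖ ^ 2 ≤ τ * stepIntegral τ (fun t => ‖f t‖ ^ 2) n := by
  have hle := norm_sq_intervalIntegral_le (timePoint_pred_le hτ n) hf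
  rwa [timePoint_sub_pred τ hn] at hle

theorem stepIntegral_mono_ae {τ T : ℝ} (hτ : 0 ≤ τ) {f g : ℝ → ℝ} (hf : IntegrableOn f (Ioc 0 T))
    (hg : IntegrableOn g (Ioc 0 T)) {n : ℕ} (hn : timePoint τ n ≤ T)
    (hfg : ∀ᵐ t ∂(volume.restrict (Ioc 0 T)), f t ≤ g t) :
    stepIntegral τ f n ≤ stepIntegral τ g n := by
  have hsub := Ioc_timePoint_subset hτ hn
  rw [stepIntegral_eq_setIntegral hτ, stepIntegral_eq_setIntegral hτ]
  exact setIntegral_mono_ae_restrict (hf.mono_set hsub) (hg.mono_set hsub)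
    (ae_restrict_of_ae_restrict_of_subset hsub hfg)

end UniformPartition

theorem integral_inner_const {α X : Type*} [MeasurableSpace α] {μ : Measure α}
    [NormedAddCommGroup X] [InnerProductSpace ℝ X] [CompleteSpace X] {f : α → X}
    (hf : Integrable f μ) (c : X) : ∫ t, ⟪f t, c⟫_ℝ ∂μ = ⟪∫ t, f t ∂μ, c⟫_ℝ := by
  simp_rw [real_inner_comm c]
  exact integral_inner hf c

theorem real_inner_le_of_norm_sq_le {X : Type*} [NormedAddCommGroup X] [InnerProductSpace ℝ X]
    {A P : ℝ} (hA : 0 ≤ A) (hP : 0 ≤ P) {x : X} (hx : ‖x‖ ^ 2 ≤ A * P) (y : X) :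
    ⟪x, y⟫_ℝ ≤ P / 2 + A / 2 * ‖y‖ ^ 2 := by
  refine (real_inner_le_norm x y).trans <|
    (sq_le_sq₀ (by positivity) (by positivity)).1 ?_
  calc (‖x‖ * ‖y‖) ^ 2 ≤ A * P * ‖y‖ ^ 2 := by rw [mul_pow]; gcongr
    _ ≤ (P / 2 + A / 2 * ‖y‖ ^ 2) ^ 2 := by linarith [sq_nonneg (P - A * ‖y‖ ^ 2)]

theorem norm_sub_sub_sub_sq_le {X : Type*} [SeminormedAddCommGroup X] (x y z w : X) :
    ‖x - y - (z - w)‖ ^ 2 ≤ 4 * (‖x‖ ^ 2 + ‖y‖ ^ 2 + ‖z‖ ^ 2 + ‖w‖ ^ 2) := by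
  have htriangle : ‖x - y - (z - w)‖ ≤ ‖x‖ + ‖y‖ + (‖z‖ + ‖w‖) :=
    (norm_sub_le _ _).trans (add_le_add (norm_sub_le _ _) (norm_sub_le _ _))
  have hsq := pow_le_pow_left₀ (norm_nonneg _) htriangle 2
  linarith [sq_nonneg (‖x‖ - ‖y‖), sq_nonneg (‖z‖ - ‖w‖), sq_nonneg (‖x‖ - ‖z‖),
    sq_nonneg (‖x‖ - ‖w‖), sq_nonneg (‖y‖ - ‖z‖), sq_nonneg (‖y‖ - ‖w‖)]

section EulerApproximation

variable {X Y V : Type*} [NormedAddCommGroup X] [InnerProductSpace ℝ X]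
  [NormedAddCommGroup Y] [InnerProductSpace ℝ Y] [AddCommGroup V] [Module ℝ V]

/-- An inf-sup condition for the pair `(φ, δ)`: the divergence `δ` has a right inverse which is
bounded by `C` when the fluxes are measured through `φ`. -/
def InfSup (φ : V →ₗ[ℝ] X) (δ : V →ₗ[ℝ] Y) (C : ℝ) : Prop :=
  ∀ w, ∃ v, δ v = w ∧ ‖φ v‖ ≤ C * ‖w‖

theorem InfSup.norm_le_of_inner_eq {φ : V →ₗ[ℝ] X} {δ : V →ₗ[ℝ] Y} {C : ℝ} (hC : 0 ≤ C)
    (h : InfSup φ δ C) {r : Y} {z : X} (hrz : ∀ v, ⟪r, δ v⟫_ℝ = ⟪z, φ v⟫_ℝ) :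
    ‖r‖ ≤ C * ‖z‖ := by
  obtain ⟨v, hv, hv_norm⟩ := h r
  rcases (norm_nonneg r).eq_or_lt with hzero | hpos
  · rw [← hzero]
    positivity
  refine le_of_mul_le_mul_left ?_ hpos
  calc ‖r‖ * ‖r‖ = ⟪z, φ v⟫_ℝ := by rw [← hrz, hv, real_inner_self_eq_norm_mul_norm]
    _ ≤ ‖z‖ * (C * ‖r‖) := (real_inner_le_norm _ _).trans (by gcongr)
    _ = ‖r‖ * (C * ‖z‖) := by ring

/-- A flow together with its implicit Euler approximation on the same time interval, whose lower
order flux terms differ by at most the monotone pairing of the saturation errors. -/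
structure IsEulerApproximation (φ : V →ₗ[ℝ] X) (δ : V →ₗ[ℝ] Y) (S : Y → Y) (T : ℝ) (ΘI : Y)
    (Bf A τ : ℝ) (N : ℕ) (Θ : ℝ → Y) (q F : ℝ → X) (Q : ℝ → V)
    (Θn : ℕ → Y) (qn : ℕ → V) (Fn : ℕ → X) : Prop where
  flow : IsFlow φ δ S T ΘI Bf Θ q F Q
  euler : IsEulerFlow φ δ S τ N ΘI Bf Θn qn Fn
  step_pos : 0 < τ
  final : timePoint τ N = T
  norm_F_sub_sq_le : ∀ n ∈ Finset.Icc 1 N, ∀ᵐ t ∂(volume.restrict (Ioc 0 T)),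
    ‖F t - Fn n‖ ^ 2 ≤ A * ⟪S (Θ t) - S (Θn n), Θ t - Θn n⟫_ℝ

/-- The accumulated flux error `∑ₙ ∫ (q - qⁿ)` up to step `m`. -/
def fluxError (φ : V →ₗ[ℝ] X) (τ : ℝ) (q : ℝ → X) (qn : ℕ → V) (m : ℕ) : X :=
  ∑ n ∈ Finset.Icc 1 m, stepIntegral τ (fun t => q t - φ (qn n)) n

/-- The monotone pairing of the saturation error with the error of `Θ`, integrated over the
`n`-th step. -/
def saturationError (S : Y → Y) (τ : ℝ) (Θ : ℝ → Y) (Θn : ℕ → Y) (n : ℕ) : ℝ :=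
  stepIntegral τ (fun t => ⟪S (Θ t) - S (Θn n), Θ t - Θn n⟫_ℝ) n

/-- An element of the flux space representing the accumulated flux error. -/
def fluxErrorLift (τ : ℝ) (Q : ℝ → V) (qn : ℕ → V) (m : ℕ) : V :=
  Q (timePoint τ m) - τ • ∑ n ∈ Finset.Icc 1 m, qn n

variable {φ : V →ₗ[ℝ] X} {δ : V →ₗ[ℝ] Y} {S : Y → Y} {Φ : Y → ℝ} {L B T : ℝ} {ΘI : Y}
  {Bf A τ : ℝ} {N : ℕ} {Θ : ℝ → Y} {q F : ℝ → X} {Q : ℝ → V}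
  {Θn : ℕ → Y} {qn : ℕ → V} {Fn : ℕ → X} {m n : ℕ}

theorem IsSaturationMap.inner_nonneg (hS : IsSaturationMap S Φ L B) (x y : Y) :
    0 ≤ ⟪S x - S y, x - y⟫_ℝ :=
  nonneg_of_mul_nonneg_right ((sq_nonneg _).trans (hS.cocoercive x y)) hS.pos

theorem IsSaturationMap.saturationError_nonneg (hS : IsSaturationMap S Φ L B) (hτ : 0 ≤ τ)
    (n : ℕ) : 0 ≤ saturationError S τ Θ Θn n :=
  stepIntegral_nonneg hτ (fun _ => hS.inner_nonneg _ _) n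

theorem IsSaturationMap.memLp_comp (hS : IsSaturationMap S Φ L B) {α : Type*} [MeasurableSpace α]
    {μ : Measure α} [IsFiniteMeasure μ] {Θ : α → Y} (hΘ : AEStronglyMeasurable Θ μ) :
    MemLp (fun t => S (Θ t)) 2 μ :=
  MemLp.of_bound (hS.continuous.comp_aestronglyMeasurable hΘ) B (ae_of_all _ fun _ => hS.norm_le _)

theorem IsSaturationMap.integrable_inner_sub (hS : IsSaturationMap S Φ L B) {α : Type*}
    [MeasurableSpace α] {μ : Measure α} [IsFiniteMeasure μ] {Θ : α → Y} (hΘ : MemLp Θ 2 μ)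
    (θ : Y) : Integrable (fun t => ⟪S (Θ t) - S θ, Θ t - θ⟫_ℝ) μ :=
  integrable_inner ((hS.memLp_comp hΘ.1).sub (memLp_const _)) (hΘ.sub (memLp_const _))

theorem IsEulerFlow.map_sum (h : IsEulerFlow φ δ S τ N ΘI Bf Θn qn Fn) (hm : m ≤ N) :
    δ (τ • ∑ n ∈ Finset.Icc 1 m, qn n) = S ΘI - S (Θn m) := by
  rw [map_smul, _root_.map_sum, Finset.smul_sum, ← neg_sub, ← h.initial,
    ← sum_Icc_sub_pred (fun n => S (Θn n)), ← Finset.sum_neg_distrib]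
  exact Finset.sum_congr rfl fun n hn =>
    eq_neg_of_add_eq_zero_right (h.mass n (Finset.Icc_subset_Icc_right hm hn))

namespace IsFlow

theorem map_Q_sub (h : IsFlow φ δ S T ΘI Bf Θ q F Q) {a b : ℝ} (ha : a ∈ Ioc 0 T)
    (hb : b ∈ Ioc 0 T) : δ (Q b - Q a) = S (Θ a) - S (Θ b) := by
  rw [map_sub, eq_neg_of_add_eq_zero_right (h.mass a ha),
    eq_neg_of_add_eq_zero_right (h.mass b hb)]
  abel

theorem norm_sq_Q_sub_le (h : IsFlow φ δ S T ΘI Bf Θ q F Q) {a t b : ℝ} (ha : 0 ≤ a)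
    (ht : t ∈ Ioc a b) (hb : b ≤ T) :
    ‖φ (Q b - Q t)‖ ^ 2 ≤ (b - a) * ∫ r in a..b, ‖q r‖ ^ 2 := by
  have hab : a ≤ b := ht.1.le.trans ht.2
  have ht0 : 0 < t := ha.trans_lt ht.1
  have hint : ∀ r ∈ Ioc 0 T, IntervalIntegrable q volume 0 r := fun r hr =>
    intervalIntegrable_of_Ioc_subset (h.memLp_q.integrable one_le_two) hr.1.le
      (Ioc_subset_Ioc_right hr.2)
  have htT : t ∈ Ioc 0 T := ⟨ht0, ht.2.trans hb⟩
  have hbT : b ∈ Ioc 0 T := ⟨ht0.trans_le ht.2, hb⟩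
  have hsq : IntervalIntegrable (fun r => ‖q r‖ ^ 2) volume a b :=
    intervalIntegrable_of_Ioc_subset (integrable_norm_sq h.memLp_q) hab (Ioc_subset_Ioc ha hb)
  rw [map_sub, h.primitive b hbT, h.primitive t htT,
    intervalIntegral.integral_interval_sub_left (hint b hbT) (hint t htT)]
  calc ‖∫ r in t..b, q r‖ ^ 2 ≤ (b - t) * ∫ r in t..b, ‖q r‖ ^ 2 :=
        norm_sq_intervalIntegral_le ht.2
          (h.memLp_q.mono_measure (Measure.restrict_mono (Ioc_subset_Ioc ht0.le hb) le_rfl))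
    _ ≤ (b - a) * ∫ r in a..b, ‖q r‖ ^ 2 := by
        gcongr
        · exact intervalIntegral.integral_nonneg ht.2 fun _ _ => sq_nonneg _
        · exact ht.1.le
        · exact intervalIntegral.integral_mono_interval ht.1.le ht.2 le_rfl
            (ae_of_all _ fun _ => sq_nonneg _) hsq

end IsFlow

namespace IsEulerApproximation

variable (h : IsEulerApproximation φ δ S T ΘI Bf A τ N Θ q F Q Θn qn Fn)

include h

theorem timePoint_mem (hn : n ∈ Finset.Icc 1 N) : timePoint τ n ∈ Ioc 0 T := by
  have hn' := Finset.mem_Icc.1 hn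
  refine ⟨mul_pos (Nat.cast_pos.2 hn'.1) h.step_pos, ?_⟩
  rw [← h.final]
  exact timePoint_mono h.step_pos.le hn'.2

theorem nonneg : 0 ≤ T := h.final ▸ timePoint_nonneg h.step_pos.le N

theorem sum_step (c : ℝ) : ∑ _n ∈ Finset.Icc 1 N, τ * c = T * c := by
  rw [Finset.sum_const, Nat.card_Icc, Nat.add_sub_cancel, nsmul_eq_mul, ← mul_assoc, ← h.final,
    timePoint]

theorem map_fluxErrorLift (hn : n ∈ Finset.Icc 1 N) :
    δ (fluxErrorLift τ Q qn n) = S (Θn n) - S (Θ (timePoint τ n)) := by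
  rw [fluxErrorLift, map_sub, h.euler.map_sum (Finset.mem_Icc.1 hn).2,
    eq_neg_of_add_eq_zero_right (h.flow.mass _ (h.timePoint_mem hn))]
  abel

theorem flux_sub_const [CompleteSpace X] (hn : n ∈ Finset.Icc 1 N) :
    stepIntegral τ (fun t => q t - φ (qn n)) n = stepIntegral τ q n - τ • φ (qn n) :=
  stepIntegral_sub_const h.step_pos.le (h.flow.memLp_q.integrable one_le_two)
    (Finset.mem_Icc.1 hn).1 (h.timePoint_mem hn).2 _

theorem fluxError_eq [CompleteSpace X] (hm : m ∈ Finset.Icc 1 N) :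
    fluxError φ τ q qn m = φ (fluxErrorLift τ Q qn m) := by
  rw [fluxErrorLift, map_sub, h.flow.primitive _ (h.timePoint_mem hm), map_smul, map_sum,
    Finset.smul_sum, ← sum_stepIntegral h.step_pos.le (h.flow.memLp_q.integrable one_le_two)
      (h.timePoint_mem hm).2, ← Finset.sum_sub_distrib]
  exact Finset.sum_congr rfl fun n hn =>
    h.flux_sub_const (Finset.Icc_subset_Icc_right (Finset.mem_Icc.1 hm).2 hn)

theorem norm_sq_stepIntegral_F_sub_le (hS : IsSaturationMap S Φ L B) (hn : n ∈ Finset.Icc 1 N) :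
    ‖stepIntegral τ (fun t => F t - Fn n) n‖ ^ 2 ≤ τ * (A * saturationError S τ Θ Θn n) := by
  have hτ := h.step_pos
  have hnT := (h.timePoint_mem hn).2
  have hF : MemLp (fun t => F t - Fn n) 2 (volume.restrict (Ioc 0 T)) :=
    h.flow.memLp_F.sub (memLp_const _)
  calc ‖stepIntegral τ (fun t => F t - Fn n) n‖ ^ 2
      ≤ τ * stepIntegral τ (fun t => ‖F t - Fn n‖ ^ 2) n :=
        norm_sq_stepIntegral_le hτ.le (Finset.mem_Icc.1 hn).1
          (hF.mono_measure (Measure.restrict_mono (Ioc_timePoint_subset hτ.le hnT) le_rfl))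
    _ ≤ τ * stepIntegral τ (fun t => A * ⟪S (Θ t) - S (Θn n), Θ t - Θn n⟫_ℝ) n := by
        gcongr
        exact stepIntegral_mono_ae hτ.le (integrable_norm_sq hF)
          ((hS.integrable_inner_sub h.flow.memLp_Θ (Θn n)).const_mul A) hnT
          (h.norm_F_sub_sq_le n hn)
    _ = τ * (A * saturationError S τ Θ Θn n) := by
        rw [saturationError, stepIntegral, stepIntegral, intervalIntegral.integral_const_mul]

theorem norm_sq_sum_stepIntegral_F_sub_le (hS : IsSaturationMap S Φ L B) :
    ‖∑ n ∈ Finset.Icc 1 N, stepIntegral τ (fun t => F t - Fn n) n‖ ^ 2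
      ≤ T * A * ∑ n ∈ Finset.Icc 1 N, saturationError S τ Θ Θn n := by
  calc ‖∑ n ∈ Finset.Icc 1 N, stepIntegral τ (fun t => F t - Fn n) n‖ ^ 2
      ≤ (∑ n ∈ Finset.Icc 1 N, ‖stepIntegral τ (fun t => F t - Fn n) n‖) ^ 2 := by
        gcongr
        exact norm_sum_le _ _
    _ ≤ N * ∑ n ∈ Finset.Icc 1 N, ‖stepIntegral τ (fun t => F t - Fn n) n‖ ^ 2 := by
        simpa using sq_sum_le_card_mul_sum_sq (s := Finset.Icc 1 N)
          (f := fun n => ‖stepIntegral τ (fun t => F t - Fn n) n‖)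
    _ ≤ N * ∑ n ∈ Finset.Icc 1 N, τ * (A * saturationError S τ Θ Θn n) := by
        gcongr with n hn
        exact h.norm_sq_stepIntegral_F_sub_le hS hn
    _ = T * A * ∑ n ∈ Finset.Icc 1 N, saturationError S τ Θ Θn n := by
        rw [← Finset.mul_sum, ← Finset.mul_sum, ← h.final, timePoint]
        ring

theorem integrableOn_sub_const {Z : Type*} [NormedAddCommGroup Z] {f : ℝ → Z}
    (hf : MemLp f 2 (volume.restrict (Ioc 0 T))) (hn : n ∈ Finset.Icc 1 N) (z : Z) :
    IntegrableOn (fun t => f t - z) (Ioc (timePoint τ (n - 1)) (timePoint τ n)) :=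
  (IntegrableOn.mono_set (hf.integrable one_le_two)
    (Ioc_timePoint_subset h.step_pos.le (h.timePoint_mem hn).2)).sub (integrable_const z)

variable [CompleteSpace X] [CompleteSpace Y]

theorem ae_inner_residual (hn : n ∈ Finset.Icc 1 N) :
    ∀ᵐ t ∂(volume.restrict (Ioc 0 T)), ∀ v,
      ⟪q t - F t - (φ (qn n) - Fn n), φ v⟫_ℝ = ⟪Θ t - Θn n, δ v⟫_ℝ := by
  filter_upwards [h.flow.ae_flux] with t ht v
  rw [inner_sub_left, ht v, inner_sub_left, inner_sub_left]
  linarith [h.euler.flux n hn v]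

-- The mass balance compares the accumulated flux with the saturation at `t_n` only; the defect
-- between `t` and `t_n` is absorbed by testing with the increment `Q (t_n) - Q t` as well.
theorem ae_inner_add_saturation_eq (hn : n ∈ Finset.Icc 1 N) :
    ∀ᵐ t ∂(volume.restrict (Ioc 0 T)),
      ⟪q t - φ (qn n), φ (fluxErrorLift τ Q qn n)⟫_ℝ + ⟪S (Θ t) - S (Θn n), Θ t - Θn n⟫_ℝ
        = ⟪F t - Fn n, φ (fluxErrorLift τ Q qn n)⟫_ℝ
          + ⟪q t - F t - (φ (qn n) - Fn n), φ (Q (timePoint τ n) - Q t)⟫_ℝ := by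
  filter_upwards [h.ae_inner_residual hn, ae_restrict_mem measurableSet_Ioc] with t hres ht
  have hlift := hres (fluxErrorLift τ Q qn n)
  rw [h.map_fluxErrorLift hn] at hlift
  have hincr := hres (Q (timePoint τ n) - Q t)
  rw [h.flow.map_Q_sub ht (h.timePoint_mem hn)] at hincr
  have hsplit : ⟪S (Θ t) - S (Θn n), Θ t - Θn n⟫_ℝ
      = ⟪Θ t - Θn n, S (Θ t) - S (Θ (timePoint τ n))⟫_ℝ
        - ⟪Θ t - Θn n, S (Θn n) - S (Θ (timePoint τ n))⟫_ℝ := by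
    rw [← inner_sub_right, sub_sub_sub_cancel_right, real_inner_comm]
  have hreorder : q t - φ (qn n) = q t - F t - (φ (qn n) - Fn n) + (F t - Fn n) := by abel
  rw [hincr, hsplit, hreorder, inner_add_left, hlift]
  ring

theorem ae_inner_fluxError_le (hA : 0 ≤ A) (hS : IsSaturationMap S Φ L B)
    (hn : n ∈ Finset.Icc 1 N) :
    ∀ᵐ t ∂(volume.restrict (Ioc (timePoint τ (n - 1)) (timePoint τ n))),
      ⟪q t - φ (qn n), fluxError φ τ q qn n⟫_ℝ + ⟪S (Θ t) - S (Θn n), Θ t - Θn n⟫_ℝ / 2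
        ≤ (A / 2 * ‖fluxError φ τ q qn n‖ ^ 2 + stepIntegral τ (fun t => ‖q t‖ ^ 2) n / 2
            + 2 * τ * (‖φ (qn n)‖ ^ 2 + 2 * Bf ^ 2)) + 2 * τ * ‖q t‖ ^ 2 := by
  have hτ := h.step_pos
  have hnT := (h.timePoint_mem hn).2
  have hsub := Ioc_timePoint_subset hτ.le hnT
  rw [h.fluxError_eq hn]
  filter_upwards [ae_restrict_of_ae_restrict_of_subset hsub (h.ae_inner_add_saturation_eq hn),
    ae_restrict_of_ae_restrict_of_subset hsub (h.norm_F_sub_sq_le n hn),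
    ae_restrict_of_ae_restrict_of_subset hsub h.flow.norm_F_le,
    ae_restrict_mem measurableSet_Ioc] with t hidentity hlower hF ht
  have hfirst := real_inner_le_of_norm_sq_le hA (hS.inner_nonneg _ _) hlower
    (φ (fluxErrorLift τ Q qn n))
  have hincr := h.flow.norm_sq_Q_sub_le (timePoint_nonneg hτ.le _) ht hnT
  rw [timePoint_sub_pred τ (Finset.mem_Icc.1 hn).1] at hincr
  have hhalf : ‖φ (Q (timePoint τ n) - Q t)‖ ^ 2 / (2 * τ)
      ≤ stepIntegral τ (fun t => ‖q t‖ ^ 2) n / 2 := by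
    rw [div_le_iff₀ (by positivity)]
    rw [stepIntegral]
    linear_combination hincr
  have hyoung := real_inner_le_young hτ (φ (Q (timePoint τ n) - Q t))
    (q t - F t - (φ (qn n) - Fn n))
  rw [real_inner_comm] at hyoung
  have hFt := pow_le_pow_left₀ (norm_nonneg _) hF 2
  have hFn := pow_le_pow_left₀ (norm_nonneg _) (h.euler.norm_F_le n hn) 2
  have hresidual := norm_sub_sub_sub_sq_le (q t) (F t) (φ (qn n)) (Fn n)
  linear_combination hidentity + hfirst + hyoung + hhalf
    + τ / 2 * (hresidual + 4 * hFt + 4 * hFn)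

theorem inner_stepIntegral_fluxError_le (hA : 0 ≤ A) (hS : IsSaturationMap S Φ L B)
    (hn : n ∈ Finset.Icc 1 N) :
    ⟪stepIntegral τ (fun t => q t - φ (qn n)) n, fluxError φ τ q qn n⟫_ℝ
        + saturationError S τ Θ Θn n / 2
      ≤ A * τ / 2 * ‖fluxError φ τ q qn n‖ ^ 2
        + τ * (5 / 2 * stepIntegral τ (fun t => ‖q t‖ ^ 2) n
          + 2 * τ * (‖φ (qn n)‖ ^ 2 + 2 * Bf ^ 2)) := by
  have hle_step := timePoint_pred_le h.step_pos.le n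
  have hsub := Ioc_timePoint_subset h.step_pos.le (h.timePoint_mem hn).2
  have hq := h.integrableOn_sub_const h.flow.memLp_q hn (φ (qn n))
  have hsat := (IntegrableOn.mono_set
    (hS.integrable_inner_sub h.flow.memLp_Θ (Θn n)) hsub).integrable.div_const 2
  have hsq := (IntegrableOn.mono_set
    (integrable_norm_sq h.flow.memLp_q) hsub).integrable.const_mul (2 * τ)
  have hle := integral_mono_ae ((hq.inner_const _).add hsat) ((integrable_const _).add hsq)
    (h.ae_inner_fluxError_le hA hS hn)
  rw [integral_add' (hq.inner_const _) hsat, integral_div, integral_add' (integrable_const _) hsq,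
    integral_const_mul, setIntegral_const, Real.volume_real_Ioc_of_le hle_step, smul_eq_mul,
    timePoint_sub_pred τ (Finset.mem_Icc.1 hn).1, integral_inner_const hq] at hle
  simp only [← stepIntegral_eq_setIntegral h.step_pos.le] at hle
  rw [saturationError]
  linear_combination hle

theorem norm_sq_fluxError_sub_le (hA : 0 ≤ A) (hS : IsSaturationMap S Φ L B)
    (hn : n ∈ Finset.Icc 1 N) :
    ‖fluxError φ τ q qn n‖ ^ 2 - ‖fluxError φ τ q qn (n - 1)‖ ^ 2
        + (‖stepIntegral τ (fun t => q t - φ (qn n)) n‖ ^ 2 + saturationError S τ Θ Θn n)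
      ≤ A * τ * ‖fluxError φ τ q qn n‖ ^ 2
        + τ * (5 * stepIntegral τ (fun t => ‖q t‖ ^ 2) n + 4 * (τ * ‖φ (qn n)‖ ^ 2)
          + τ * (8 * Bf ^ 2)) := by
  have hprev : fluxError φ τ q qn (n - 1)
      = fluxError φ τ q qn n - stepIntegral τ (fun t => q t - φ (qn n)) n := by
    obtain ⟨k, rfl⟩ := Nat.exists_eq_add_of_le' (Finset.mem_Icc.1 hn).1
    rw [Nat.add_sub_cancel, fluxError, fluxError, Finset.sum_Icc_succ_top (by omega),
      add_sub_cancel_right]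
  rw [hprev, norm_sub_sq_real, real_inner_comm]
  linear_combination 2 * h.inner_stepIntegral_fluxError_le hA hS hn

theorem sum_residual_le (hS : IsSaturationMap S Φ L B) :
    ∑ n ∈ Finset.Icc 1 N, τ * (5 * stepIntegral τ (fun t => ‖q t‖ ^ 2) n
        + 4 * (τ * ‖φ (qn n)‖ ^ 2) + τ * (8 * Bf ^ 2))
      ≤ τ * (18 * energy S Φ ΘI + 17 * (Bf ^ 2 * T)) := by
  have hflow := h.flow.integral_norm_sq_le h.nonneg hS
  rw [← intervalIntegral.integral_of_le h.nonneg] at hflow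
  have heuler := h.euler.sum_norm_sq_le h.step_pos.le hS
  rw [show (N : ℝ) * τ = T from h.final] at heuler
  rw [← Finset.mul_sum, Finset.sum_add_distrib, Finset.sum_add_distrib, ← Finset.mul_sum,
    ← Finset.mul_sum, h.sum_step,
    sum_stepIntegral h.step_pos.le (integrable_norm_sq h.flow.memLp_q) h.final.le, h.final]
  refine mul_le_mul_of_nonneg_left ?_ h.step_pos.le
  linarith

theorem sum_saturationError_add_le (hA : 0 ≤ A) (hS : IsSaturationMap S Φ L B)
    (hsmall : A * τ ≤ 1 / 2) :
    ∑ n ∈ Finset.Icc 1 N, saturationError S τ Θ Θn n + ‖fluxError φ τ q qn N‖ ^ 2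
        + ∑ n ∈ Finset.Icc 1 N, ‖stepIntegral τ (fun t => q t - φ (qn n)) n‖ ^ 2
      ≤ τ * (18 * energy S Φ ΘI + 17 * (Bf ^ 2 * T))
        * (1 + A * T * Real.exp (2 * (A * T))) := by
  have hτ := h.step_pos
  have hNA : (N : ℝ) * (A * τ) = A * T := by
    rw [← h.final, timePoint]
    ring
  have hgronwall := add_sum_le_of_sub_pred_add_le (x := fun n => ‖fluxError φ τ q qn n‖ ^ 2)
    (by simp [fluxError]) (fun n => sq_nonneg _)
    (fun n => add_nonneg (sq_nonneg ‖stepIntegral τ (fun t => q t - φ (qn n)) n‖)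
      (hS.saturationError_nonneg hτ.le n))
    (fun n => by
      have := stepIntegral_nonneg hτ.le (fun t => sq_nonneg ‖q t‖) n
      positivity)
    (by positivity) hsmall (h.sum_residual_le hS)
    (fun n hn => h.norm_sq_fluxError_sub_le hA hS hn)
  rw [hNA, Finset.sum_add_distrib] at hgronwall
  linarith

theorem inner_stepIntegral_Θ_sub (hn : n ∈ Finset.Icc 1 N) (v : V) :
    ⟪stepIntegral τ (fun t => Θ t - Θn n) n, δ v⟫_ℝ
      = ⟪stepIntegral τ (fun t => q t - φ (qn n)) n - stepIntegral τ (fun t => F t - Fn n) n,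
          φ v⟫_ℝ := by
  have hsub := Ioc_timePoint_subset h.step_pos.le (h.timePoint_mem hn).2
  have hq := h.integrableOn_sub_const h.flow.memLp_q hn (φ (qn n))
  have hF := h.integrableOn_sub_const h.flow.memLp_F hn (Fn n)
  simp only [stepIntegral_eq_setIntegral h.step_pos.le]
  rw [← integral_inner_const (h.integrableOn_sub_const h.flow.memLp_Θ hn (Θn n)),
    ← integral_sub' hq hF, ← integral_inner_const (hq.sub hF)]
  refine integral_congr_ae ?_
  filter_upwards [ae_restrict_of_ae_restrict_of_subset hsub (h.ae_inner_residual hn)] with t ht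
  rw [← ht v]
  congr 1
  simp only [Pi.sub_apply]
  abel

theorem norm_sq_sum_stepIntegral_Θ_sub_le (hS : IsSaturationMap S Φ L B) {C : ℝ} (hC : 0 ≤ C)
    (hinf : InfSup φ δ C) :
    ‖∑ n ∈ Finset.Icc 1 N, stepIntegral τ (fun t => Θ t - Θn n) n‖ ^ 2
      ≤ 2 * C ^ 2 * (‖fluxError φ τ q qn N‖ ^ 2
        + T * A * ∑ n ∈ Finset.Icc 1 N, saturationError S τ Θ Θn n) := by
  set H := ∑ n ∈ Finset.Icc 1 N, stepIntegral τ (fun t => F t - Fn n) n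
  calc ‖∑ n ∈ Finset.Icc 1 N, stepIntegral τ (fun t => Θ t - Θn n) n‖ ^ 2
      ≤ (C * ‖fluxError φ τ q qn N - H‖) ^ 2 := by
        gcongr
        refine hinf.norm_le_of_inner_eq hC fun v => ?_
        rw [fluxError, ← Finset.sum_sub_distrib, sum_inner, sum_inner]
        exact Finset.sum_congr rfl fun n hn => h.inner_stepIntegral_Θ_sub hn v
    _ ≤ C ^ 2 * (2 * (‖fluxError φ τ q qn N‖ ^ 2 + ‖H‖ ^ 2)) := by
        rw [mul_pow]
        gcongr
        linarith [parallelogram_law_with_norm ℝ (fluxError φ τ q qn N) H,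
          mul_self_nonneg ‖fluxError φ τ q qn N + H‖]
    _ ≤ 2 * C ^ 2 * (‖fluxError φ τ q qn N‖ ^ 2
        + T * A * ∑ n ∈ Finset.Icc 1 N, saturationError S τ Θ Θn n) := by
        linear_combination 2 * C ^ 2 * h.norm_sq_sum_stepIntegral_F_sub_le hS

end IsEulerApproximation

theorem exists_isEulerApproximation_error_le [CompleteSpace X] [CompleteSpace Y] (hA : 0 ≤ A)
    (hS : IsSaturationMap S Φ L B) {C : ℝ} (hC : 0 ≤ C) (hinf : InfSup φ δ C) (T : ℝ) (ΘI : Y)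
    (Bf : ℝ) :
    ∃ K τ₀, 0 < τ₀ ∧ ∀ (τ : ℝ) (N : ℕ) (Θ : ℝ → Y) (q F : ℝ → X) (Q : ℝ → V) (Θn : ℕ → Y)
      (qn : ℕ → V) (Fn : ℕ → X), IsEulerApproximation φ δ S T ΘI Bf A τ N Θ q F Q Θn qn Fn →
      τ ≤ τ₀ →
      ∑ n ∈ Finset.Icc 1 N, saturationError S τ Θ Θn n + ‖fluxError φ τ q qn N‖ ^ 2
          + ∑ n ∈ Finset.Icc 1 N, ‖stepIntegral τ (fun t => q t - φ (qn n)) n‖ ^ 2 ≤ K * τ ∧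
        ‖∑ n ∈ Finset.Icc 1 N, stepIntegral τ (fun t => Θ t - Θn n) n‖ ^ 2 ≤ K * τ := by
  let K := (18 * energy S Φ ΘI + 17 * (Bf ^ 2 * T)) * (1 + A * T * Real.exp (2 * (A * T)))
  refine ⟨max K (2 * C ^ 2 * (1 + T * A) * K), 1 / (2 * (A + 1)), by positivity,
    fun τ N Θ q F Q Θn qn Fn h hτ => ?_⟩
  have hτ₀ := h.step_pos
  have hT := h.nonneg
  have hsmall : A * τ ≤ 1 / 2 := by
    rw [le_div_iff₀ (by positivity)] at hτ
    linarith
  have hmain : _ ≤ K * τ := (h.sum_saturationError_add_le hA hS hsmall).trans_eq (by ring)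
  have hflux := sq_nonneg ‖fluxError φ τ q qn N‖
  have hsaturation := Finset.sum_nonneg fun n (_ : n ∈ Finset.Icc 1 N) =>
    hS.saturationError_nonneg (Θ := Θ) (Θn := Θn) hτ₀.le n
  have hsteps := Finset.sum_nonneg fun n (_ : n ∈ Finset.Icc 1 N) =>
    sq_nonneg ‖stepIntegral τ (fun t => q t - φ (qn n)) n‖
  constructor
  · refine hmain.trans ?_
    gcongr
    exact le_max_left _ _
  · calc ‖∑ n ∈ Finset.Icc 1 N, stepIntegral τ (fun t => Θ t - Θn n) n‖ ^ 2
        ≤ 2 * C ^ 2 * (‖fluxError φ τ q qn N‖ ^ 2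
          + T * A * ∑ n ∈ Finset.Icc 1 N, saturationError S τ Θ Θn n) :=
          h.norm_sq_sum_stepIntegral_Θ_sub_le hS hC hinf
      _ ≤ 2 * C ^ 2 * (K * τ + T * A * (K * τ)) := by
          gcongr <;> linarith
      _ = 2 * C ^ 2 * (1 + T * A) * K * τ := by ring
      _ ≤ max K (2 * C ^ 2 * (1 + T * A) * K) * τ := by
          gcongr
          exact le_max_right _ _

end EulerApproximation

theorem le_mul_of_mul_sq_le {a b c m x : ℝ} (ha : 0 < a) (hb : 0 ≤ b) (hc : 0 ≤ c) (hm : 0 ≤ m)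
    (h : a * x ^ 2 ≤ b * m * x + c * m ^ 2) : x ≤ ((b + c) / a + 1) * m := by
  by_contra! hlt
  have hratio : 0 ≤ (b + c) / a * m := by positivity
  have hmx : m ≤ x := by linarith
  have hx : 0 < x := by linarith
  have hlinear : a * x ≤ (b + c) * m := by
    refine le_of_mul_le_mul_right ?_ hx
    have : c * m * m ≤ c * m * x := by gcongr
    linarith
  have hscaled : (b + c) / a * m < x := by linarith
  rw [div_mul_eq_mul_div, div_lt_iff₀ ha] at hscaled
  linarith

section MixedProblem

variable {X Y V : Type*} [NormedAddCommGroup X] [InnerProductSpace ℝ X]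
  [NormedAddCommGroup Y] [InnerProductSpace ℝ Y] [AddCommGroup V] [Module ℝ V]

/-- The mixed problem `⟪z, φ v⟫ - ⟪r, δ v⟫ = ⟪G, φ v⟫` for a flux `e` and a pressure `r`. The vector
`z` stands for `𝒜 (φ e)` with an operator `𝒜` which is coercive with constant `al` and bounded by
`au` at `φ e`. -/
structure IsMixedSolution (φ : V →ₗ[ℝ] X) (δ : V →ₗ[ℝ] Y) (al au : ℝ) (z G : X) (e : V)
    (r : Y) : Prop where
  coercive : al * ‖φ e‖ ^ 2 ≤ ⟪z, φ e⟫_ℝ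
  norm_le : ‖z‖ ≤ au * ‖φ e‖
  eq : ∀ v, ⟪z, φ v⟫_ℝ - ⟪r, δ v⟫_ℝ = ⟪G, φ v⟫_ℝ

/-- The stability constant for the flux in a mixed problem. -/
def fluxStability (C al au : ℝ) : ℝ := (1 + C * au + C) / al + 1

/-- The stability constant for the pressure in a mixed problem. -/
def pressureStability (C al au : ℝ) : ℝ := C * (au * fluxStability C al au + 1)

theorem fluxStability_nonneg {C al au : ℝ} (hC : 0 ≤ C) (hal : 0 ≤ al) (hau : 0 ≤ au) :
    0 ≤ fluxStability C al au := by
  rw [fluxStability]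
  positivity

namespace IsMixedSolution

variable {φ : V →ₗ[ℝ] X} {δ : V →ₗ[ℝ] Y} {C al au : ℝ} {z G : X} {e : V} {r : Y}
  (h : IsMixedSolution φ δ al au z G e r) (hinf : InfSup φ δ C) (hC : 0 ≤ C)

include h hinf hC

theorem norm_pressure_le_flux : ‖r‖ ≤ C * (au * ‖φ e‖ + ‖G‖) := by
  have hrz : ‖r‖ ≤ C * ‖z - G‖ := hinf.norm_le_of_inner_eq hC fun v => by
    rw [inner_sub_left, ← h.eq v]
    ring
  refine hrz.trans ?_
  gcongr
  exact (norm_sub_le _ _).trans (by gcongr; exact h.norm_le)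

theorem norm_flux_le (hal : 0 < al) (hau : 0 ≤ au) :
    ‖φ e‖ ≤ fluxStability C al au * (‖G‖ + ‖δ e‖) := by
  have hδ : ‖δ e‖ ≤ ‖G‖ + ‖δ e‖ := le_add_of_nonneg_left (norm_nonneg _)
  have hG : ‖G‖ ≤ ‖G‖ + ‖δ e‖ := le_add_of_nonneg_right (norm_nonneg _)
  refine le_mul_of_mul_sq_le hal (by positivity) hC (by positivity) ?_
  calc al * ‖φ e‖ ^ 2 ≤ ⟪z, φ e⟫_ℝ := h.coercive
    _ = ⟪G, φ e⟫_ℝ + ⟪r, δ e⟫_ℝ := by rw [← h.eq e, sub_add_cancel]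
    _ ≤ ‖G‖ * ‖φ e‖ + ‖r‖ * ‖δ e‖ := by gcongr <;> exact real_inner_le_norm _ _
    _ ≤ (‖G‖ + ‖δ e‖) * ‖φ e‖ + C * (au * ‖φ e‖ + (‖G‖ + ‖δ e‖)) * (‖G‖ + ‖δ e‖) := by
        gcongr
        exact (h.norm_pressure_le_flux hinf hC).trans (by gcongr)
    _ = (1 + C * au) * (‖G‖ + ‖δ e‖) * ‖φ e‖ + C * (‖G‖ + ‖δ e‖) ^ 2 := by ring

theorem norm_pressure_le (hal : 0 < al) (hau : 0 ≤ au) :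
    ‖r‖ ≤ pressureStability C al au * (‖G‖ + ‖δ e‖) := by
  calc ‖r‖ ≤ C * (au * ‖φ e‖ + ‖G‖) := h.norm_pressure_le_flux hinf hC
    _ ≤ C * (au * (fluxStability C al au * (‖G‖ + ‖δ e‖)) + (‖G‖ + ‖δ e‖)) := by
        gcongr
        · exact h.norm_flux_le hinf hC hal hau
        · exact le_add_of_nonneg_right (norm_nonneg _)
    _ = pressureStability C al au * (‖G‖ + ‖δ e‖) := by
        rw [pressureStability]
        ring

end IsMixedSolution

end MixedProblem

section Poincare

variable {E : Type*} [NormedAddCommGroup E] [NormedSpace ℝ E] [FiniteDimensional ℝ E]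
  [MeasurableSpace E] [BorelSpace E] (μ : Measure E) [μ.IsAddHaarMeasure]

theorem integral_sq_eq_integral_mul_fderiv {φ : E → ℝ} (hφ : ContDiff ℝ 1 φ)
    (hc : HasCompactSupport φ) (ℓ : E →L[ℝ] ℝ) {e : E} (he : ℓ e = 1) :
    ∫ x, φ x ^ 2 ∂μ = ∫ x, -2 * ℓ x * fderiv ℝ φ x e * φ x ∂μ := by
  have hdiff : Differentiable ℝ φ := hφ.differentiable one_ne_zero
  have hfderiv : Continuous fun x => fderiv ℝ φ x e :=
    (hφ.continuous_fderiv one_ne_zero).clm_apply continuous_const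
  have hℓ : ∀ x, fderiv ℝ ℓ x e = 1 := fun x => by rw [ℓ.fderiv, he]
  have hsq : ∀ x, fderiv ℝ (fun y => φ y ^ 2) x e = 2 * (φ x * fderiv ℝ φ x e) := fun x => by
    rw [fderiv_fun_pow 2 (hdiff x)]
    simp [mul_assoc]
  have hcsq : HasCompactSupport fun x => φ x ^ 2 := by
    simp only [sq]
    exact hc.mul_right
  have hbp := integral_mul_fderiv_eq_neg_fderiv_mul_of_integrable (𝕜 := ℝ) (μ := μ) (f := ℓ)
    (g := fun x => φ x ^ 2) (v := e)
    (by
      simp only [hℓ, one_mul]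
      exact (hφ.continuous.pow 2).integrable_of_hasCompactSupport hcsq)
    (by
      simp only [hsq]
      exact (ℓ.continuous.mul (continuous_const.mul (hφ.continuous.mul hfderiv))
        ).integrable_of_hasCompactSupport hc.mul_right.mul_left.mul_left)
    ((ℓ.continuous.mul (hφ.continuous.pow 2)).integrable_of_hasCompactSupport hcsq.mul_left)
    (fun x _ => ℓ.differentiableAt) (fun x _ => (hdiff x).pow 2)
  simp only [hℓ, hsq, one_mul] at hbp
  rw [← neg_eq_iff_eq_neg.2 hbp, ← integral_neg]
  exact integral_congr_ae (ae_of_all _ fun x => by ring)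

end Poincare

section Divergence

variable {d : ℕ} {Ω : Set (Space d)}

/-- The test functions on `Ω`: smooth functions on `ℝ^d` whose support is a compact subset of
`Ω`. -/
def testSpace (Ω : Set (Space d)) : Submodule ℝ (Space d → ℝ) where
  carrier := {φ | ContDiff ℝ ∞ φ ∧ HasCompactSupport φ ∧ tsupport φ ⊆ Ω}
  add_mem' hf hg := ⟨hf.1.add hg.1, hf.2.1.add hg.2.1,
    (tsupport_add _ _).trans (union_subset hf.2.2 hg.2.2)⟩
  zero_mem' := ⟨contDiff_const, HasCompactSupport.zero, by simp⟩
  smul_mem' c f hf := ⟨contDiff_const.smul hf.1, hf.2.1.smul_left (f := fun _ => c),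
    (tsupport_smul_subset_right (fun _ => c) f).trans hf.2.2⟩

/-- The embedding of the test functions into `L²(Ω)`. -/
def testInclusion (Ω : Set (Space d)) : testSpace Ω →ₗ[ℝ] L2 Ω where
  toFun φ := (testFun_memLp Ω φ.2.1 φ.2.2.1).toLp _
  map_add' _ _ := rfl
  map_smul' _ _ := rfl

/-- The gradient of a test function as an element of `L²(Ω)^d`. -/
def testGradient (Ω : Set (Space d)) : testSpace Ω →ₗ[ℝ] L2vec Ω where
  toFun φ := (gradient_memLp Ω φ.2.1 φ.2.2.1).toLp _
  map_add' φ ψ := by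
    rw [← MemLp.toLp_add]
    refine MemLp.toLp_congr _ _ (ae_of_all _ fun x => ?_)
    simp only [gradient, Submodule.coe_add, Pi.add_apply]
    rw [← map_add, fderiv_add (φ.2.1.differentiable (by simp) x)
      (ψ.2.1.differentiable (by simp) x)]
  map_smul' c φ := by
    rw [RingHom.id_apply, ← MemLp.toLp_const_smul]
    refine MemLp.toLp_congr _ _ (ae_of_all _ fun x => ?_)
    simp only [gradient, Submodule.coe_smul, Pi.smul_apply]
    rw [fderiv_const_smul (φ.2.1.differentiable (by simp) x), map_smulₛₗ]
    rfl

theorem setIntegral_eq_integral_of_mem_testSpace (φ : testSpace Ω) {g : Space d → ℝ}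
    (hg : ∀ x, φ.1 x = 0 → g x = 0) : ∫ x in Ω, g x = ∫ x, g x :=
  setIntegral_eq_integral_of_forall_compl_eq_zero fun x hx =>
    hg x (image_eq_zero_of_notMem_tsupport fun hx' => hx (φ.2.2.2 hx'))

theorem norm_testInclusion_sq (φ : testSpace Ω) :
    ‖testInclusion Ω φ‖ ^ 2 = ∫ x, φ.1 x ^ 2 := by
  rw [← setIntegral_eq_integral_of_mem_testSpace φ fun x hx => by simp [hx],
    ← real_inner_self_eq_norm_sq]
  refine (integral_mul_testFun Ω φ.2.1 φ.2.2.1 (testInclusion Ω φ)).symm.trans ?_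
  refine integral_congr_ae ?_
  filter_upwards [(testFun_memLp Ω φ.2.1 φ.2.2.1).coeFn_toLp] with x hx
  rw [show testInclusion Ω φ x = φ.1 x from hx, sq]

theorem norm_mul_fderiv_le_norm_gradient {R : ℝ} (hR : ∀ x ∈ Ω, ‖x‖ ≤ R) (φ : testSpace Ω)
    (i : Fin d) (x : Space d) :
    ‖-2 * x i * fderiv ℝ φ.1 x (EuclideanSpace.single i 1)‖ ≤ 2 * R * ‖gradient φ.1 x‖ := by
  have hgrad : ‖gradient φ.1 x‖ = ‖fderiv ℝ φ.1 x‖ := LinearIsometryEquiv.norm_map _ _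
  by_cases hx : x ∈ Ω
  · have hxi : ‖x i‖ ≤ R := (PiLp.norm_apply_le x i).trans (hR x hx)
    have hfderiv : ‖fderiv ℝ φ.1 x (EuclideanSpace.single i 1)‖ ≤ ‖gradient φ.1 x‖ := by
      simpa [hgrad] using (fderiv ℝ φ.1 x).le_opNorm (EuclideanSpace.single i 1)
    have hR0 : 0 ≤ R := (norm_nonneg _).trans hxi
    rw [norm_mul, norm_mul, norm_neg, Real.norm_two]
    gcongr
  · have hfderiv : fderiv ℝ φ.1 x = 0 := by
      by_contra hne
      exact hx (φ.2.2.2 (support_fderiv_subset ℝ hne))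
    simp [hgrad, hfderiv]

theorem norm_testInclusion_le {R : ℝ} (hd : 1 ≤ d) (hR : ∀ x ∈ Ω, ‖x‖ ≤ R) (φ : testSpace Ω) :
    ‖testInclusion Ω φ‖ ≤ 2 * R * ‖testGradient Ω φ‖ := by
  let i : Fin d := ⟨0, hd⟩
  let e : Space d := EuclideanSpace.single i 1
  let g : Space d → ℝ := fun x => -2 * x i * fderiv ℝ φ.1 x e
  have hcont : Continuous g :=
    (continuous_const.mul (EuclideanSpace.proj (𝕜 := ℝ) i).continuous).mul
      ((φ.2.1.continuous_fderiv (by simp)).clm_apply continuous_const)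
  have hsupp : HasCompactSupport g := (φ.2.2.1.fderiv_apply ℝ e).mul_left
  have hg : MemLp g 2 (volume.restrict Ω) := (hcont.memLp_of_hasCompactSupport hsupp).restrict Ω
  have hpoincare : ‖testInclusion Ω φ‖ ^ 2 = ⟪hg.toLp g, testInclusion Ω φ⟫_ℝ := by
    rw [norm_testInclusion_sq, integral_sq_eq_integral_mul_fderiv volume (φ.2.1.of_le (by simp))
      φ.2.2.1 (EuclideanSpace.proj i) (e := e) (by simp [e]),
      ← setIntegral_eq_integral_of_mem_testSpace φ fun x hx => by simp [hx]]
    refine Eq.trans (integral_congr_ae ?_) (integral_mul_testFun Ω φ.2.1 φ.2.2.1 (hg.toLp g))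
    filter_upwards [hg.coeFn_toLp] with x hx
    rw [hx]
    rfl
  have hnorm : ‖hg.toLp g‖ ≤ 2 * R * ‖testGradient Ω φ‖ := by
    refine Lp.norm_le_mul_norm_of_ae_le_mul ?_
    filter_upwards [hg.coeFn_toLp, (gradient_memLp Ω φ.2.1 φ.2.2.1).coeFn_toLp] with x hx hx'
    rw [hx, show testGradient Ω φ x = gradient φ.1 x from hx']
    exact norm_mul_fderiv_le_norm_gradient hR φ i x
  refine le_trans ?_ hnorm
  have hcs := real_inner_le_norm (hg.toLp g) (testInclusion Ω φ)
  rw [← hpoincare, sq] at hcs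
  by_contra! hlt
  exact hcs.not_gt (mul_lt_mul_of_pos_right hlt ((norm_nonneg _).trans_lt hlt))

theorem exists_norm_le_inner_eq {D X : Type*} [AddCommGroup D] [Module ℝ D]
    [NormedAddCommGroup X] [InnerProductSpace ℝ X] [CompleteSpace X] (A : D →ₗ[ℝ] X)
    (f : D →ₗ[ℝ] ℝ) {C : ℝ} (hC : 0 ≤ C) (hf : ∀ x, ‖f x‖ ≤ C * ‖A x‖) :
    ∃ y : X, ‖y‖ ≤ C ∧ ∀ x, ⟪y, A x⟫_ℝ = f x := by
  have hker : A.ker ≤ f.ker := fun x hx => by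
    simpa [LinearMap.mem_ker.1 hx] using hf x
  let g : A.range →ₗ[ℝ] ℝ := (A.ker.liftQ f hker).comp A.quotKerEquivRange.symm.toLinearMap
  have hg : ∀ x, g (A.rangeRestrict x) = f x := fun x =>
    congrArg (A.ker.liftQ f hker) (A.quotKerEquivRange_symm_apply_image x _)
  have hgC : ∀ y, ‖g y‖ ≤ C * ‖y‖ := by
    rintro ⟨_, x, rfl⟩
    exact (congrArg norm (hg x)).trans_le (hf x)
  obtain ⟨l, hl, hlC⟩ := exists_extension_norm_eq _ (g.mkContinuous C hgC)
  refine ⟨(InnerProductSpace.toDual ℝ X).symm l, ?_, fun x => ?_⟩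
  · rw [LinearIsometryEquiv.norm_map, hlC]
    exact LinearMap.mkContinuous_norm_le _ hC _
  · rw [InnerProductSpace.toDual_symm_apply]
    exact (hl (A.rangeRestrict x)).trans (hg x)

/-- The underlying field `v` of an element of `H(div; Ω)`, as a linear map. -/
def fieldₗ (Ω : Set (Space d)) : Hdiv Ω →ₗ[ℝ] L2vec Ω where
  toFun := Hdiv.field
  map_add' _ _ := rfl
  map_smul' _ _ := rfl

/-- The divergence `∇·v` of an element of `H(div; Ω)`, as a linear map. -/
def divₗ (Ω : Set (Space d)) : Hdiv Ω →ₗ[ℝ] L2 Ω where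
  toFun := Hdiv.div
  map_add' _ _ := rfl
  map_smul' _ _ := rfl

theorem exists_infSup (hd : 1 ≤ d) (hΩb : Bornology.IsBounded Ω) :
    ∃ C, 0 ≤ C ∧ InfSup (fieldₗ Ω) (divₗ Ω) C := by
  obtain ⟨R, hR0, hR⟩ := hΩb.exists_pos_norm_le
  refine ⟨2 * R, by positivity, fun w => ?_⟩
  have hbound : ∀ φ, ‖-⟪w, testInclusion Ω φ⟫_ℝ‖ ≤ 2 * R * ‖w‖ * ‖testGradient Ω φ‖ := fun φ => by
    rw [norm_neg]
    calc ‖⟪w, testInclusion Ω φ⟫_ℝ‖ ≤ ‖w‖ * ‖testInclusion Ω φ‖ := norm_inner_le_norm _ _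
      _ ≤ ‖w‖ * (2 * R * ‖testGradient Ω φ‖) := by
        gcongr
        exact norm_testInclusion_le hd hR φ
      _ = 2 * R * ‖w‖ * ‖testGradient Ω φ‖ := by ring
  obtain ⟨v, hv, hvφ⟩ := exists_norm_le_inner_eq (testGradient Ω)
    (-(innerₛₗ ℝ w).comp (testInclusion Ω)) (by positivity) hbound
  refine ⟨⟨WithLp.toLp 2 (v, w), fun φ h hc hs => ?_⟩, rfl, hv⟩
  rw [integral_inner_gradient Ω h hc, integral_mul_testFun Ω h hc]
  exact hvφ ⟨φ, h, hc, hs⟩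

end Divergence

theorem aestronglyMeasurable_comp_of_ae_continuousAt {α E G : Type*} [MeasurableSpace α]
    {μ : Measure α} [TopologicalSpace E] [TopologicalSpace G]
    [TopologicalSpace.PseudoMetrizableSpace G] {f : α → E} {g : E → G}
    (hf : AEStronglyMeasurable f μ) (hg : ∀ᵐ a ∂μ, ContinuousAt g (f a)) :
    AEStronglyMeasurable (fun a => g (f a)) μ := by
  obtain ⟨f', hf', hff'⟩ := hf
  refine aestronglyMeasurable_of_tendsto_ae atTop (f := fun n a => g (hf'.approx n a))
    (fun n => (SimpleFunc.stronglyMeasurable ((hf'.approx n).map g)).aestronglyMeasurable) ?_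
  filter_upwards [hg, hff'] with a ha hfa
  exact ha.tendsto.comp (hfa ▸ hf'.tendsto_approx a)

theorem sub_mul_le_primitive_sub {s : ℝ → ℝ} (hs : Monotone s) (x y : ℝ) :
    (x - y) * s y ≤ (∫ r in (0 : ℝ)..x, s r) - ∫ r in (0 : ℝ)..y, s r := by
  have hi : ∀ a b, IntervalIntegrable s volume a b := fun a b => hs.intervalIntegrable
  rw [intervalIntegral.integral_interval_sub_left (hi _ _) (hi _ _)]
  rcases le_total y x with h | h
  · simpa using intervalIntegral.integral_mono_on (μ := volume) h
      (intervalIntegrable_const (c := s y)) (hi y x) fun r hr => hs hr.1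
  · have hle := intervalIntegral.integral_mono_on (μ := volume) h (hi x y)
      (intervalIntegrable_const (c := s y)) fun r hr => hs hr.2
    rw [intervalIntegral.integral_const, smul_eq_mul] at hle
    rw [intervalIntegral.integral_symm]
    linear_combination hle

theorem sq_sub_le_of_monotone_of_lipschitzWith {s : ℝ → ℝ} (hs : Monotone s) {K : NNReal}
    (hK : LipschitzWith K s) (x y : ℝ) : (s x - s y) ^ 2 ≤ K * ((s x - s y) * (x - y)) := by
  have hmono : 0 ≤ (s x - s y) * (x - y) := by
    rcases le_total x y with h | h
    · exact mul_nonneg_of_nonpos_of_nonpos (sub_nonpos.2 (hs h)) (sub_nonpos.2 h)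
    · exact mul_nonneg (sub_nonneg.2 (hs h)) (sub_nonneg.2 h)
  calc (s x - s y) ^ 2 = |s x - s y| * |s x - s y| := by rw [abs_mul_abs_self, sq]
    _ ≤ |s x - s y| * (K * |x - y|) := by
      gcongr
      exact hK.dist_le_mul x y
    _ = K * ((s x - s y) * (x - y)) := by rw [← abs_of_nonneg hmono, abs_mul]; ring

section Superposition

variable {d : ℕ} {Ω : Set (Space d)} {F : Type*} [NormedAddCommGroup F]

theorem coeFn_toL2 {g : Space d → F} (h : MemLp g 2 (volume.restrict Ω)) :
    toL2 Ω g =ᵐ[volume.restrict Ω] g := by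
  rw [toL2, dif_pos h]
  exact h.coeFn_toLp

namespace Coeffs

variable {c : Coeffs d}

namespace Admissible

variable (hc : c.Admissible) (hΩb : Bornology.IsBounded Ω)
include hc

section Multiplication

variable {g : ℝ → ℝ}

theorem toL2_smul_sub (hg : Continuous g) (θ : L2 Ω) (v v' : L2vec Ω) :
    toL2 Ω (fun x => g (c.s (θ x)) • (v - v') x)
      = toL2 Ω (fun x => g (c.s (θ x)) • v x) - toL2 Ω (fun x => g (c.s (θ x)) • v' x) := by
  refine Lp.ext ?_
  filter_upwards [Lp.coeFn_sub (toL2 Ω (fun x => g (c.s (θ x)) • v x))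
    (toL2 Ω (fun x => g (c.s (θ x)) • v' x)), Lp.coeFn_sub v v',
    coeFn_toL2 (hc.memLp_smul hg θ v), coeFn_toL2 (hc.memLp_smul hg θ v'),
    coeFn_toL2 (hc.memLp_smul hg θ (v - v'))] with x hsub hvv' hv hv' hmul
  rw [hsub, hmul, Pi.sub_apply, hv, hv', hvv', Pi.sub_apply, smul_sub]

theorem norm_toL2_smul_le (hg : Continuous g) {M : ℝ} (hM : ∀ y, |g y| ≤ M) (θ : L2 Ω)
    (v : L2vec Ω) : ‖toL2 Ω (fun x => g (c.s (θ x)) • v x)‖ ≤ M * ‖v‖ := by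
  refine Lp.norm_le_mul_norm_of_ae_le_mul ?_
  filter_upwards [coeFn_toL2 (hc.memLp_smul hg θ v)] with x hx
  rw [hx, norm_smul]
  exact mul_le_mul_of_nonneg_right (hM _) (norm_nonneg _)

theorem le_inner_aMul {m : ℝ} (hm : ∀ y, m ≤ c.a y) (θ : L2 Ω) (v : L2vec Ω) :
    m * ‖v‖ ^ 2 ≤ ⟪c.aMul θ v, v⟫_ℝ := by
  obtain ⟨K, hK⟩ := hc.a_lip
  rw [← real_inner_self_eq_norm_sq, L2.inner_def, L2.inner_def, ← integral_const_mul]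
  refine integral_mono_ae ((L2.integrable_inner v v).const_mul m) (L2.integrable_inner _ _) ?_
  filter_upwards [coeFn_toL2 (hc.memLp_smul hK.continuous θ v)] with x hx
  rw [show (c.aMul θ v : Space d → Space d) x = c.a (c.s (θ x)) • v x from hx,
    real_inner_smul_left]
  exact mul_le_mul_of_nonneg_right (hm _) real_inner_self_nonneg

end Multiplication

include hΩb

theorem coeFn_sat (θ : L2 Ω) : c.sat θ =ᵐ[volume.restrict Ω] fun x => c.s (θ x) :=
  coeFn_toL2 (hc.memLp_comp hΩb continuous_id θ)

theorem norm_toL2_comp_sub_le {g : ℝ → F} {K : NNReal} (hg : LipschitzWith K g) (θ θ' : L2 Ω) :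
    ‖toL2 Ω (fun x => g (c.s (θ x))) - toL2 Ω (fun x => g (c.s (θ' x)))‖
      ≤ K * ‖c.sat θ - c.sat θ'‖ := by
  refine Lp.norm_le_mul_norm_of_ae_le_mul ?_
  filter_upwards [Lp.coeFn_sub (toL2 Ω (fun x => g (c.s (θ x)))) (toL2 Ω (fun x => g (c.s (θ' x)))),
    Lp.coeFn_sub (c.sat θ) (c.sat θ'), coeFn_toL2 (hc.memLp_comp hΩb hg.continuous θ),
    coeFn_toL2 (hc.memLp_comp hΩb hg.continuous θ'), hc.coeFn_sat hΩb θ, hc.coeFn_sat hΩb θ']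
    with x hg_sub hsat_sub hgθ hgθ' hθ hθ'
  rw [hg_sub, hsat_sub, Pi.sub_apply, Pi.sub_apply, hgθ, hgθ', hθ, hθ', ← dist_eq_norm,
    ← dist_eq_norm]
  exact hg.dist_le_mul _ _

theorem norm_toL2_smul_sub_le {g : ℝ → ℝ} {K : NNReal} (hg : LipschitzWith K g) {M : ℝ}
    (θ θ' : L2 Ω) {v : L2vec Ω} (hv : ∀ᵐ x ∂(volume.restrict Ω), ‖v x‖ ≤ M) :
    ‖toL2 Ω (fun x => g (c.s (θ x)) • v x) - toL2 Ω (fun x => g (c.s (θ' x)) • v x)‖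
      ≤ K * M * ‖c.sat θ - c.sat θ'‖ := by
  refine Lp.norm_le_mul_norm_of_ae_le_mul ?_
  filter_upwards [Lp.coeFn_sub (toL2 Ω (fun x => g (c.s (θ x)) • v x))
    (toL2 Ω (fun x => g (c.s (θ' x)) • v x)), Lp.coeFn_sub (c.sat θ) (c.sat θ'),
    coeFn_toL2 (hc.memLp_smul hg.continuous θ v), coeFn_toL2 (hc.memLp_smul hg.continuous θ' v),
    hc.coeFn_sat hΩb θ, hc.coeFn_sat hΩb θ', hv] with x hg_sub hsat_sub hgθ hgθ' hθ hθ' hvx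
  rw [hg_sub, hsat_sub, Pi.sub_apply, Pi.sub_apply, hgθ, hgθ', hθ, hθ', ← sub_smul, norm_smul,
    mul_right_comm, ← dist_eq_norm, ← dist_eq_norm]
  gcongr
  exact hg.dist_le_mul _ _

theorem exists_norm_toL2_comp_le {g : ℝ → F} (hg : Continuous g) :
    ∃ B, ∀ θ : L2 Ω, ‖toL2 Ω (fun x => g (c.s (θ x)))‖ ≤ B := by
  obtain ⟨M, hM⟩ := (isCompact_Icc (a := (0 : ℝ)) (b := 1)).exists_bound_of_continuousOn
    hg.continuousOn
  have : IsFiniteMeasure (volume.restrict Ω) := ⟨by simpa using hΩb.measure_lt_top⟩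
  refine ⟨_, fun θ => Lp.norm_le_of_ae_bound ((norm_nonneg _).trans (hM 0 (by simp))) ?_⟩
  filter_upwards [coeFn_toL2 (hc.memLp_comp hΩb hg θ)] with x hx
  rw [hx]
  exact hM _ (hc.s_mem _)

end Admissible

/-- The convex potential `θ ↦ ∫_Ω ∫₀^{θ(x)} s(r) dr dx`, whose subgradient is `c.sat`. -/
def potential (c : Coeffs d) (θ : L2 Ω) : ℝ := ∫ x in Ω, ∫ r in (0 : ℝ)..θ x, c.s r

namespace Admissible

variable (hc : c.Admissible) (hΩb : Bornology.IsBounded Ω)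
include hc hΩb

theorem integrable_primitive_comp (θ : L2 Ω) :
    Integrable (fun x => ∫ r in (0 : ℝ)..θ x, c.s r) (volume.restrict Ω) := by
  have : IsFiniteMeasure (volume.restrict Ω) := ⟨by simpa using hΩb.measure_lt_top⟩
  have hcont : Continuous fun y => ∫ r in (0 : ℝ)..y, c.s r :=
    intervalIntegral.continuous_primitive (fun a b => hc.s_mono.intervalIntegrable) 0
  refine ((Lp.memLp θ).integrable one_le_two).mono
    (hcont.comp_aestronglyMeasurable (Lp.aestronglyMeasurable θ)) (ae_of_all _ fun x => ?_)
  simpa using intervalIntegral.norm_integral_le_of_norm_le_const (a := 0) (b := θ x) (f := c.s)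
    (C := 1) fun r _ => by rw [Real.norm_of_nonneg (hc.s_mem r).1]; exact (hc.s_mem r).2

theorem inner_sat_le_potential_sub (θ θ' : L2 Ω) :
    ⟪θ - θ', c.sat θ'⟫_ℝ ≤ c.potential θ - c.potential θ' := by
  have hi := hc.integrable_primitive_comp hΩb (Ω := Ω)
  rw [L2.inner_def, potential, potential, ← integral_sub (hi θ) (hi θ')]
  refine integral_mono_ae (L2.integrable_inner _ _) ((hi θ).sub (hi θ')) ?_
  filter_upwards [hc.coeFn_sat hΩb θ', Lp.coeFn_sub θ θ'] with x hsat hsub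
  rw [hsat, hsub]
  simpa [mul_comm] using sub_mul_le_primitive_sub hc.s_mono (θ x) (θ' x)

theorem norm_sat_sub_sq_le {K : NNReal} (hK : LipschitzWith K c.s) (θ θ' : L2 Ω) :
    ‖c.sat θ - c.sat θ'‖ ^ 2 ≤ K * ⟪c.sat θ - c.sat θ', θ - θ'⟫_ℝ := by
  rw [← real_inner_self_eq_norm_sq, L2.inner_def, L2.inner_def, ← integral_const_mul]
  refine integral_mono_ae (L2.integrable_inner _ _) ((L2.integrable_inner _ _).const_mul _) ?_
  filter_upwards [hc.coeFn_sat hΩb θ, hc.coeFn_sat hΩb θ', Lp.coeFn_sub θ θ',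
    Lp.coeFn_sub (c.sat θ) (c.sat θ')] with x hθ hθ' hsub hsat_sub
  rw [hsub, hsat_sub, Pi.sub_apply, Pi.sub_apply, hθ, hθ']
  simpa [sq, mul_comm] using sq_sub_le_of_monotone_of_lipschitzWith hc.s_mono hK (θ x) (θ' x)

theorem exists_isSaturationMap :
    ∃ L B, IsSaturationMap (c.sat : L2 Ω → L2 Ω) c.potential L B := by
  obtain ⟨K, hK⟩ := hc.s_lip
  obtain ⟨B, hB⟩ := hc.exists_norm_toL2_comp_le hΩb continuous_id
  exact ⟨(K + 1 : NNReal), B, by positivity, hc.inner_sat_le_potential_sub hΩb, hB,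
    hc.norm_sat_sub_sq_le hΩb (hK.weaken le_self_add)⟩

theorem continuous_sat : Continuous (c.sat : L2 Ω → L2 Ω) := by
  obtain ⟨_, _, hS⟩ := hc.exists_isSaturationMap hΩb (Ω := Ω)
  exact hS.continuous

theorem continuous_toL2_comp {g : ℝ → F} {K : NNReal} (hg : LipschitzWith K g) :
    Continuous fun θ : L2 Ω => toL2 Ω fun x => g (c.s (θ x)) := by
  refine continuous_iff_continuousAt.2 fun θ => tendsto_iff_norm_sub_tendsto_zero.2 ?_
  have hcont : Continuous fun θ' : L2 Ω => K * ‖c.sat θ' - c.sat θ‖ :=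
    continuous_const.mul ((hc.continuous_sat hΩb).sub continuous_const).norm
  refine squeeze_zero (fun _ => norm_nonneg _)
    (fun θ' => hc.norm_toL2_comp_sub_le hΩb hg θ' θ) ?_
  simpa using hcont.tendsto θ

end Admissible

end Coeffs

end Superposition

section Darcy

variable {d : ℕ} {Ω : Set (Space d)} {c : Coeffs d}

/-- The total flow equations `∇·u = f₂(s(θ))` and `a(s(θ)) u + ∇p + f₃(s(θ)) = 0`, in weak form, for
the velocity `u` and the pressure `p` at a given saturation variable `θ`. They hold at every time of
the continuous problem and in every step of the scheme. -/
structure IsDarcyPair (c : Coeffs d) (θ p : L2 Ω) (u : Hdiv Ω) : Prop where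
  div_eq : u.div = c.f2Sat θ
  darcy : ∀ v : Hdiv Ω,
    ⟪c.aMul θ u.field, v.field⟫_ℝ - ⟪p, v.div⟫_ℝ + ⟪c.f3Sat θ, v.field⟫_ℝ = 0

theorem IsContinuousSolution.isDarcyPair {T : ℝ} {ΘI : L2 Ω} {Θ : ℝ → L2 Ω} {q : ℝ → L2vec Ω}
    {p : ℝ → L2 Ω} {u : ℝ → Hdiv Ω} (h : IsContinuousSolution c Ω T ΘI Θ q p u) {t : ℝ}
    (ht : t ∈ Ioc 0 T) : IsDarcyPair c (Θ t) (p t) (u t) :=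
  ⟨ext_inner_right ℝ (h.totalMass t ht), h.darcy t ht⟩

theorem IsSemiDiscreteStep.isDarcyPair {τ : ℝ} {θ₀ θ p : L2 Ω} {q u : Hdiv Ω}
    (h : IsSemiDiscreteStep c Ω τ θ₀ θ q p u) : IsDarcyPair c θ p u :=
  ⟨ext_inner_right ℝ h.totalMass, h.darcy⟩

theorem Coeffs.Admissible.exists_a_bounds (hc : c.Admissible) :
    ∃ al au, 0 < al ∧ 0 ≤ au ∧ (∀ y, al ≤ c.a y) ∧ ∀ y, |c.a y| ≤ au := by
  obtain ⟨al, au, hal, hab⟩ := hc.a_bounds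
  have hpos : ∀ y, 0 < c.a y := fun y => hal.trans_le (hab y).1
  exact ⟨al, au, hal, (hpos 0).le.trans (hab 0).2, fun y => (hab y).1,
    fun y => (abs_of_pos (hpos y)).trans_le (hab y).2⟩

namespace IsDarcyPair

variable {θ p θ' p' : L2 Ω} {u u' : Hdiv Ω} {al au : ℝ}

theorem isMixedSolution (h : IsDarcyPair c θ p u) (hc : c.Admissible)
    (hal : ∀ y, al ≤ c.a y) (hau : ∀ y, |c.a y| ≤ au) :
    IsMixedSolution (fieldₗ Ω) (divₗ Ω) al au (c.aMul θ u.field) (-c.f3Sat θ) u p where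
  coercive := hc.le_inner_aMul hal θ u.field
  norm_le := by
    obtain ⟨K, hK⟩ := hc.a_lip
    exact hc.norm_toL2_smul_le hK.continuous hau θ u.field
  eq v := by
    rw [inner_neg_left]
    exact eq_neg_of_add_eq_zero_left (h.darcy v)

theorem isMixedSolution_sub (h : IsDarcyPair c θ p u) (h' : IsDarcyPair c θ' p' u')
    (hc : c.Admissible) (hal : ∀ y, al ≤ c.a y) (hau : ∀ y, |c.a y| ≤ au) :
    IsMixedSolution (fieldₗ Ω) (divₗ Ω) al au (c.aMul θ' (u.field - u'.field))
      (-(c.aMul θ u.field - c.aMul θ' u.field) - (c.f3Sat θ - c.f3Sat θ')) (u - u') (p - p') where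
  coercive := hc.le_inner_aMul hal θ' (u.field - u'.field)
  norm_le := by
    obtain ⟨K, hK⟩ := hc.a_lip
    exact hc.norm_toL2_smul_le hK.continuous hau θ' (u.field - u'.field)
  eq v := by
    obtain ⟨K, hK⟩ := hc.a_lip
    have hsub : c.aMul θ' (u.field - u'.field) = c.aMul θ' u.field - c.aMul θ' u'.field :=
      hc.toL2_smul_sub hK.continuous θ' u.field u'.field
    change ⟪_, v.field⟫_ℝ - ⟪_, v.div⟫_ℝ = ⟪_, v.field⟫_ℝ
    simp only [hsub, inner_sub_left, inner_neg_left]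
    linear_combination h.darcy v - h'.darcy v

end IsDarcyPair

namespace Coeffs

/-- The lower order flux `f_w(s(θ)) v + f₁(s(θ))`. -/
def lowerFlux (c : Coeffs d) (θ : L2 Ω) (v : L2vec Ω) : L2vec Ω :=
  c.fwMul θ v + c.f1Sat θ

namespace Admissible

theorem exists_norm_velocity_le (hc : c.Admissible) (hd : 1 ≤ d) (hΩb : Bornology.IsBounded Ω) :
    ∃ B, ∀ (θ p : L2 Ω) (u : Hdiv Ω), IsDarcyPair c θ p u → ‖u.field‖ ≤ B := by
  obtain ⟨C, hC, hinf⟩ := exists_infSup hd hΩb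
  obtain ⟨al, au, hal0, hau0, hal, hau⟩ := hc.exists_a_bounds
  obtain ⟨K2, hK2⟩ := hc.f2_lip
  obtain ⟨K3, hK3⟩ := hc.f3_lip
  obtain ⟨B2, hB2⟩ := hc.exists_norm_toL2_comp_le hΩb hK2.continuous
  obtain ⟨B3, hB3⟩ := hc.exists_norm_toL2_comp_le hΩb hK3.continuous
  have hF := fluxStability_nonneg hC hal0.le hau0
  refine ⟨fluxStability C al au * (B3 + B2), fun θ p u h => ?_⟩
  refine ((h.isMixedSolution hc hal hau).norm_flux_le hinf hC hal0 hau0).trans ?_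
  gcongr
  · rw [norm_neg]
    exact hB3 θ
  · exact (congrArg norm h.div_eq).trans_le (hB2 θ)

theorem exists_norm_darcyPair_sub_le (hc : c.Admissible) (hd : 1 ≤ d)
    (hΩb : Bornology.IsBounded Ω) {M : ℝ} (hM : 0 ≤ M) :
    ∃ C, 0 ≤ C ∧ ∀ (θ p θ' p' : L2 Ω) (u u' : Hdiv Ω),
      IsDarcyPair c θ p u → IsDarcyPair c θ' p' u' →
      (∀ᵐ x ∂(volume.restrict Ω), ‖u.field x‖ ≤ M) →
      ‖u.field - u'.field‖ ≤ C * ‖c.sat θ - c.sat θ'‖ ∧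
        ‖p - p'‖ ≤ C * ‖c.sat θ - c.sat θ'‖ := by
  obtain ⟨C, hC, hinf⟩ := exists_infSup hd hΩb
  obtain ⟨al, au, hal0, hau0, hal, hau⟩ := hc.exists_a_bounds
  obtain ⟨Ka, hKa⟩ := hc.a_lip
  obtain ⟨K2, hK2⟩ := hc.f2_lip
  obtain ⟨K3, hK3⟩ := hc.f3_lip
  have hF := fluxStability_nonneg hC hal0.le hau0
  refine ⟨max (fluxStability C al au) (pressureStability C al au) * (Ka * M + K3 + K2),
    by positivity, fun θ p θ' p' u u' h h' hu => ?_⟩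
  have hmixed := h.isMixedSolution_sub h' hc hal hau
  have hdata : ‖-(c.aMul θ u.field - c.aMul θ' u.field) - (c.f3Sat θ - c.f3Sat θ')‖
      + ‖divₗ Ω (u - u')‖ ≤ (Ka * M + K3 + K2) * ‖c.sat θ - c.sat θ'‖ := by
    rw [add_mul, add_mul]
    gcongr
    · refine (norm_sub_le _ _).trans ?_
      rw [norm_neg]
      exact add_le_add (hc.norm_toL2_smul_sub_le hΩb hKa θ θ' hu)
        (hc.norm_toL2_comp_sub_le hΩb hK3 θ θ')
    · change ‖u.div - u'.div‖ ≤ _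
      rw [h.div_eq, h'.div_eq]
      exact hc.norm_toL2_comp_sub_le hΩb hK2 θ θ'
  rw [mul_assoc]
  constructor
  · refine (hmixed.norm_flux_le hinf hC hal0 hau0).trans ?_
    gcongr
    exact le_max_left _ _
  · refine (hmixed.norm_pressure_le hinf hC hal0 hau0).trans ?_
    gcongr
    exact le_max_right _ _

theorem exists_norm_lowerFlux_le (hc : c.Admissible) (hd : 1 ≤ d) (hΩb : Bornology.IsBounded Ω) :
    ∃ B, ∀ (θ p : L2 Ω) (u : Hdiv Ω), IsDarcyPair c θ p u → ‖c.lowerFlux θ u.field‖ ≤ B := by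
  obtain ⟨Bu, hBu⟩ := hc.exists_norm_velocity_le hd hΩb
  obtain ⟨Kw, hKw⟩ := hc.fw_lip
  obtain ⟨Mw, hMw⟩ := hc.fw_bdd
  obtain ⟨K1, hK1⟩ := hc.f1_lip
  obtain ⟨B1, hB1⟩ := hc.exists_norm_toL2_comp_le hΩb hK1.continuous
  have hMw0 : 0 ≤ Mw := (abs_nonneg _).trans (hMw 0)
  refine ⟨Mw * Bu + B1, fun θ p u h => (norm_add_le _ _).trans (add_le_add ?_ (hB1 θ))⟩
  exact (hc.norm_toL2_smul_le hKw.continuous hMw θ u.field).trans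
    (mul_le_mul_of_nonneg_left (hBu θ p u h) hMw0)

theorem exists_norm_lowerFlux_sub_le (hc : c.Admissible) (hΩb : Bornology.IsBounded Ω) {M : ℝ}
    (hM : 0 ≤ M) :
    ∃ C C', 0 ≤ C ∧ 0 ≤ C' ∧ ∀ (θ θ' : L2 Ω) (v v' : L2vec Ω),
      (∀ᵐ x ∂(volume.restrict Ω), ‖v x‖ ≤ M) →
      ‖c.lowerFlux θ v - c.lowerFlux θ' v'‖ ≤ C * ‖c.sat θ - c.sat θ'‖ + C' * ‖v - v'‖ := by
  obtain ⟨Kw, hKw⟩ := hc.fw_lip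
  obtain ⟨Mw, hMw⟩ := hc.fw_bdd
  obtain ⟨K1, hK1⟩ := hc.f1_lip
  have hMw0 : 0 ≤ Mw := (abs_nonneg _).trans (hMw 0)
  refine ⟨Kw * M + K1, Mw, by positivity, hMw0, fun θ θ' v v' hv => ?_⟩
  have hfw : ‖c.fwMul θ v - c.fwMul θ' v‖ ≤ Kw * M * ‖c.sat θ - c.sat θ'‖ :=
    hc.norm_toL2_smul_sub_le hΩb hKw θ θ' hv
  have hfw' : ‖c.fwMul θ' (v - v')‖ ≤ Mw * ‖v - v'‖ :=
    hc.norm_toL2_smul_le hKw.continuous hMw θ' (v - v')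
  have hf1 : ‖c.f1Sat θ - c.f1Sat θ'‖ ≤ K1 * ‖c.sat θ - c.sat θ'‖ :=
    hc.norm_toL2_comp_sub_le hΩb hK1 θ θ'
  have hmul_sub : c.fwMul θ' (v - v') = c.fwMul θ' v - c.fwMul θ' v' :=
    hc.toL2_smul_sub hKw.continuous θ' v v'
  have hsplit : c.lowerFlux θ v - c.lowerFlux θ' v'
      = (c.fwMul θ v - c.fwMul θ' v) + c.fwMul θ' (v - v') + (c.f1Sat θ - c.f1Sat θ') := by
    rw [hmul_sub, lowerFlux, lowerFlux]
    abel
  calc ‖c.lowerFlux θ v - c.lowerFlux θ' v'‖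
      ≤ ‖c.fwMul θ v - c.fwMul θ' v‖ + ‖c.fwMul θ' (v - v')‖ + ‖c.f1Sat θ - c.f1Sat θ'‖ :=
        hsplit ▸ norm_add₃_le
    _ ≤ (Kw * M + K1) * ‖c.sat θ - c.sat θ'‖ + Mw * ‖v - v'‖ := by
        linear_combination hfw + hfw' + hf1

theorem exists_norm_lowerFlux_sub_le_of_isDarcyPair (hc : c.Admissible) (hd : 1 ≤ d)
    (hΩb : Bornology.IsBounded Ω) {M : ℝ} (hM : 0 ≤ M) :
    ∃ K, ∀ (θ p θ' p' : L2 Ω) (u u' : Hdiv Ω),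
      IsDarcyPair c θ p u → IsDarcyPair c θ' p' u' →
      (∀ᵐ x ∂(volume.restrict Ω), ‖u.field x‖ ≤ M) →
      ‖c.lowerFlux θ u.field - c.lowerFlux θ' u'.field‖ ≤ K * ‖c.sat θ - c.sat θ'‖ := by
  obtain ⟨C, -, hdarcy⟩ := hc.exists_norm_darcyPair_sub_le hd hΩb hM
  obtain ⟨C₁, C₂, -, hC₂, hlower⟩ := hc.exists_norm_lowerFlux_sub_le hΩb hM
  refine ⟨C₁ + C₂ * C, fun θ p θ' p' u u' h h' hu => ?_⟩
  linear_combination hlower θ θ' u.field u'.field hu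
    + C₂ * (hdarcy θ p θ' p' u u' h h' hu).1

theorem continuousAt_lowerFlux (hc : c.Admissible) (hΩb : Bornology.IsBounded Ω) {M : ℝ}
    (hM : 0 ≤ M) (θ : L2 Ω) {v : L2vec Ω} (hv : ∀ᵐ x ∂(volume.restrict Ω), ‖v x‖ ≤ M) :
    ContinuousAt (fun z : L2 Ω × L2vec Ω => c.lowerFlux z.1 z.2) (θ, v) := by
  obtain ⟨C, C', -, -, hlower⟩ := hc.exists_norm_lowerFlux_sub_le hΩb hM
  refine tendsto_iff_norm_sub_tendsto_zero.2 ?_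
  have hcont : Continuous fun z : L2 Ω × L2vec Ω =>
      C * ‖c.sat θ - c.sat z.1‖ + C' * ‖v - z.2‖ :=
    (continuous_const.mul (continuous_const.sub
      ((hc.continuous_sat hΩb).comp continuous_fst)).norm).add
      (continuous_const.mul (continuous_const.sub continuous_snd).norm)
  refine squeeze_zero (fun _ => norm_nonneg _) (fun z => ?_)
    (by simpa using hcont.tendsto (θ, v))
  rw [norm_sub_rev]
  exact hlower θ z.1 v z.2 hv

variable {α : Type*} [MeasurableSpace α] {μ : Measure α} {Θ : α → L2 Ω} {v : α → L2vec Ω}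

theorem aestronglyMeasurable_lowerFlux (hc : c.Admissible) (hΩb : Bornology.IsBounded Ω) {M : ℝ}
    (hM : 0 ≤ M) (hΘ : AEStronglyMeasurable Θ μ) (hv : AEStronglyMeasurable v μ)
    (hvM : ∀ᵐ t ∂μ, ∀ᵐ x ∂(volume.restrict Ω), ‖v t x‖ ≤ M) :
    AEStronglyMeasurable (fun t => c.lowerFlux (Θ t) (v t)) μ :=
  aestronglyMeasurable_comp_of_ae_continuousAt (f := fun t => (Θ t, v t))
    (g := fun z : L2 Ω × L2vec Ω => c.lowerFlux z.1 z.2) (hΘ.prodMk hv)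
    (hvM.mono fun t ht => hc.continuousAt_lowerFlux hΩb hM (Θ t) ht)

theorem integrable_f1Sat [IsFiniteMeasure μ] (hc : c.Admissible) (hΩb : Bornology.IsBounded Ω)
    (hΘ : AEStronglyMeasurable Θ μ) : Integrable (fun t => c.f1Sat (Θ t)) μ := by
  obtain ⟨K, hK⟩ := hc.f1_lip
  obtain ⟨B, hB⟩ := hc.exists_norm_toL2_comp_le hΩb hK.continuous
  exact Integrable.of_bound ((hc.continuous_toL2_comp hΩb hK).comp_aestronglyMeasurable hΘ) B
    (ae_of_all _ fun t => hB (Θ t))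

end Admissible

end Coeffs

end Darcy

section TimeMean

variable {X : Type*} [NormedAddCommGroup X] [InnerProductSpace ℝ X] [CompleteSpace X]
  {T τ C : ℝ} {n : ℕ} {g : ℝ → X} {σ : ℝ → ℝ}

theorem timeMean_sub (hτ : 0 < τ) (hn : 1 ≤ n) (hnT : timePoint τ n ≤ T)
    (hg : IntegrableOn g (Ioc 0 T)) (x : X) :
    timeMean τ g n - x = τ⁻¹ • stepIntegral τ (fun t => g t - x) n := by
  rw [stepIntegral_sub_const hτ.le hg hn hnT, smul_sub, inv_smul_smul₀ hτ.ne', timeMean,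
    stepIntegral]

theorem mul_norm_timeMean_sub_sq_le (hτ : 0 < τ) (hn : 1 ≤ n) (hnT : timePoint τ n ≤ T)
    (hg : MemLp g 2 (volume.restrict (Ioc 0 T))) (x : X)
    (hσ : IntegrableOn (fun t => σ t ^ 2) (Ioc 0 T))
    (hgσ : ∀ᵐ t ∂(volume.restrict (Ioc 0 T)), ‖g t - x‖ ≤ C * σ t) :
    τ * ‖timeMean τ g n - x‖ ^ 2 ≤ C ^ 2 * stepIntegral τ (fun t => σ t ^ 2) n := by
  have hgx : MemLp (fun t => g t - x) 2 (volume.restrict (Ioc 0 T)) := hg.sub (memLp_const x)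
  have hsub := Ioc_timePoint_subset hτ.le hnT
  have hpointwise : ∀ᵐ t ∂(volume.restrict (Ioc 0 T)), ‖g t - x‖ ^ 2 ≤ C ^ 2 * σ t ^ 2 := by
    filter_upwards [hgσ] with t ht
    rw [← mul_pow]
    gcongr
  calc τ * ‖timeMean τ g n - x‖ ^ 2
      = τ⁻¹ * ‖stepIntegral τ (fun t => g t - x) n‖ ^ 2 := by
        rw [timeMean_sub hτ hn hnT (hg.integrable one_le_two), norm_smul, norm_inv,
          Real.norm_of_nonneg hτ.le]
        field_simp
    _ ≤ τ⁻¹ * (τ * stepIntegral τ (fun t => ‖g t - x‖ ^ 2) n) := by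
        gcongr
        exact norm_sq_stepIntegral_le hτ.le hn
          (hgx.mono_measure (Measure.restrict_mono hsub le_rfl))
    _ = stepIntegral τ (fun t => ‖g t - x‖ ^ 2) n := inv_mul_cancel_left₀ hτ.ne' _
    _ ≤ stepIntegral τ (fun t => C ^ 2 * σ t ^ 2) n :=
        stepIntegral_mono_ae hτ.le (integrable_norm_sq hgx) (hσ.const_mul _) hnT hpointwise
    _ = C ^ 2 * stepIntegral τ (fun t => σ t ^ 2) n :=
        intervalIntegral.integral_const_mul _ _

end TimeMean

section Scheme

variable {d : ℕ} {Ω : Set (Space d)} {c : Coeffs d} {T M τ : ℝ} {N : ℕ} {ΘI : L2 Ω}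
  {Θ : ℝ → L2 Ω} {q : ℝ → L2vec Ω} {p : ℝ → L2 Ω} {u : ℝ → Hdiv Ω}
  {Θn : ℕ → L2 Ω} {qn : ℕ → Hdiv Ω} {pn : ℕ → L2 Ω} {un : ℕ → Hdiv Ω}

theorem memLp_field {α : Type*} [MeasurableSpace α] {μ : Measure α} {v : α → Hdiv Ω}
    (hv : MemLp v 2 μ) : MemLp (fun t => (v t).field) 2 μ :=
  ((WithLp.fstL 2 ℝ (L2vec Ω) (L2 Ω)).comp (divGraph Ω).subtypeL).comp_memLp' hv

theorem MemL2Time.memLp_Ioc {X : Type*} [NormedAddCommGroup X] {g : ℝ → X} (hg : MemL2Time T g) :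
    MemLp g 2 (volume.restrict (Ioc 0 T)) := by
  rwa [← Measure.restrict_congr_set Ioo_ae_eq_Ioc]

theorem IsContinuousSolution.lowerFlux_eq (h : IsContinuousSolution c Ω T ΘI Θ q p u)
    (hf1 : IntegrableOn (fun t => c.f1Sat (Θ t)) (Ioc 0 T))
    (hF : IntegrableOn (fun t => c.lowerFlux (Θ t) (u t).field) (Ioc 0 T)) {t : ℝ}
    (ht : t ∈ Ioc 0 T) (v : Hdiv Ω) :
    ⟪∫ y in (0 : ℝ)..t, q y, v.field⟫_ℝ - ⟪∫ y in (0 : ℝ)..t, Θ y, v.div⟫_ℝ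
      = ⟪∫ y in (0 : ℝ)..t, c.lowerFlux (Θ y) (u y).field, v.field⟫_ℝ := by
  have hsub : Ioc 0 t ⊆ Ioc 0 T := Ioc_subset_Ioc_right ht.2
  have hsplit : ∫ y in (0 : ℝ)..t, c.fwMul (Θ y) (u y).field
      = (∫ y in (0 : ℝ)..t, c.lowerFlux (Θ y) (u y).field)
        - ∫ y in (0 : ℝ)..t, c.f1Sat (Θ y) := by
    rw [← intervalIntegral.integral_sub (intervalIntegrable_of_Ioc_subset hF ht.1.le hsub)
      (intervalIntegrable_of_Ioc_subset hf1 ht.1.le hsub)]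
    simp only [Coeffs.lowerFlux, add_sub_cancel_right]
  have hflux := h.flux t ht v
  rw [hsplit, inner_sub_left] at hflux
  linarith

theorem IsContinuousSolution.exists_isFlow (h : IsContinuousSolution c Ω T ΘI Θ q p u)
    (hc : c.Admissible) (hΩb : Bornology.IsBounded Ω) (hM : 0 ≤ M)
    (hu : ∀ᵐ t ∂(volume.restrict (Ioc 0 T)), ∀ᵐ x ∂(volume.restrict Ω), ‖(u t).field x‖ ≤ M)
    {Bf : ℝ}
    (hBf : ∀ (θ p : L2 Ω) (u : Hdiv Ω), IsDarcyPair c θ p u → ‖c.lowerFlux θ u.field‖ ≤ Bf) :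
    ∃ Q : ℝ → Hdiv Ω, IsFlow (fieldₗ Ω) (divₗ Ω) c.sat T ΘI Bf Θ q
      (fun t => c.lowerFlux (Θ t) (u t).field) Q := by
  obtain ⟨Q, -, hQ, hmass⟩ := h.mass
  have hΘ := h.Θ_mem.memLp_Ioc
  have hF := hc.aestronglyMeasurable_lowerFlux hΩb hM hΘ.1 (memLp_field h.u_mem.memLp_Ioc).1 hu
  have hF_le : ∀ᵐ t ∂(volume.restrict (Ioc 0 T)), ‖c.lowerFlux (Θ t) (u t).field‖ ≤ Bf :=
    ae_restrict_of_forall_mem measurableSet_Ioc fun t ht => hBf _ _ _ (h.isDarcyPair ht)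
  exact ⟨Q, {
    memLp_Θ := hΘ
    memLp_q := h.q_mem.memLp_Ioc
    aestronglyMeasurable_F := hF
    norm_F_le := hF_le
    primitive := fun t ht => hQ t (Ioc_subset_Icc_self ht)
    mass := fun t ht => ext_inner_right ℝ fun w => by
      rw [inner_add_left, inner_zero_left]
      exact hmass t ht w
    flux := fun t ht => h.lowerFlux_eq (hc.integrable_f1Sat hΩb hΘ.1)
      (Integrable.of_bound hF Bf hF_le) ht }⟩

theorem IsSemiDiscreteSolution.isEulerFlow (h : IsSemiDiscreteSolution c Ω τ N ΘI Θn qn pn un)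
    {Bf : ℝ}
    (hBf : ∀ (θ p : L2 Ω) (u : Hdiv Ω), IsDarcyPair c θ p u → ‖c.lowerFlux θ u.field‖ ≤ Bf) :
    IsEulerFlow (fieldₗ Ω) (divₗ Ω) c.sat τ N ΘI Bf Θn qn
      (fun n => c.lowerFlux (Θn n) (un n).field) where
  initial := h.1
  norm_F_le n hn := hBf _ _ _ (h.2 n hn).isDarcyPair
  mass n hn := ext_inner_right ℝ fun w => by
    rw [inner_add_left, inner_zero_left, real_inner_smul_left]
    exact (h.2 n hn).mass w
  flux n hn v := by
    change ⟪(qn n).field, v.field⟫_ℝ - ⟪Θn n, v.div⟫_ℝ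
      = ⟪c.lowerFlux (Θn n) (un n).field, v.field⟫_ℝ
    rw [Coeffs.lowerFlux, inner_add_left]
    linear_combination (h.2 n hn).flux v

/-- A solution `(Θ, q, p, u)` of the continuous problem with velocity bounded by `M`, together with
a semi-discrete solution `(Θⁿ, qⁿ, pⁿ, uⁿ)` on the partition of `[0, T]` into `N` steps of size
`τ`. -/
structure IsSchemePair (c : Coeffs d) (T : ℝ) (ΘI : L2 Ω) (M : ℝ) (N : ℕ) (τ : ℝ)
    (Θ : ℝ → L2 Ω) (q : ℝ → L2vec Ω) (p : ℝ → L2 Ω) (u : ℝ → Hdiv Ω)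
    (Θn : ℕ → L2 Ω) (qn : ℕ → Hdiv Ω) (pn : ℕ → L2 Ω) (un : ℕ → Hdiv Ω) : Prop where
  continuous : IsContinuousSolution c Ω T ΘI Θ q p u
  velocity_le : ∀ᵐ t ∂(volume.restrict (Ioo 0 T)), ∀ᵐ x ∂(volume.restrict Ω), ‖(u t).field x‖ ≤ M
  one_le : 1 ≤ N
  step_eq : τ = T / N
  discrete : IsSemiDiscreteSolution c Ω τ N ΘI Θn qn pn un

namespace IsSchemePair

variable (h : IsSchemePair c T ΘI M N τ Θ q p u Θn qn pn un)

include h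

theorem step_pos (hT : 0 < T) : 0 < τ :=
  h.step_eq ▸ div_pos hT (Nat.cast_pos.2 h.one_le)

theorem timePoint_eq : timePoint τ N = T := by
  have hN : (N : ℝ) ≠ 0 := Nat.cast_ne_zero.2 (Nat.one_le_iff_ne_zero.1 h.one_le)
  rw [timePoint, h.step_eq, mul_div_cancel₀ _ hN]

theorem ae_velocity_le_abs : ∀ᵐ t ∂(volume.restrict (Ioc 0 T)), ∀ᵐ x ∂(volume.restrict Ω),
    ‖(u t).field x‖ ≤ |M| := by
  rw [← Measure.restrict_congr_set Ioo_ae_eq_Ioc]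
  exact h.velocity_le.mono fun t ht => ht.mono fun x hx => hx.trans (le_abs_self M)

theorem ae_of_isDarcyPair {P : L2 Ω → L2 Ω → Hdiv Ω → L2 Ω → L2 Ω → Hdiv Ω → Prop}
    (hP : ∀ (θ p θ' p' : L2 Ω) (u u' : Hdiv Ω), IsDarcyPair c θ p u → IsDarcyPair c θ' p' u' →
      (∀ᵐ x ∂(volume.restrict Ω), ‖u.field x‖ ≤ |M|) → P θ p u θ' p' u')
    {n : ℕ} (hn : n ∈ Finset.Icc 1 N) :
    ∀ᵐ t ∂(volume.restrict (Ioc 0 T)), P (Θ t) (p t) (u t) (Θn n) (pn n) (un n) := by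
  filter_upwards [h.ae_velocity_le_abs, ae_restrict_mem measurableSet_Ioc] with t hu ht
  exact hP _ _ _ _ _ _ (h.continuous.isDarcyPair ht) (h.discrete.2 n hn).isDarcyPair hu

end IsSchemePair

namespace Coeffs.Admissible

theorem exists_isEulerApproximation (hc : c.Admissible) (hd : 1 ≤ d)
    (hΩb : Bornology.IsBounded Ω) (hT : 0 < T) (ΘI : L2 Ω) (M : ℝ) :
    ∃ A Bf, 0 ≤ A ∧ ∀ (N : ℕ) (τ : ℝ) (Θ : ℝ → L2 Ω) (q : ℝ → L2vec Ω) (p : ℝ → L2 Ω)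
      (u : ℝ → Hdiv Ω) (Θn : ℕ → L2 Ω) (qn : ℕ → Hdiv Ω) (pn : ℕ → L2 Ω) (un : ℕ → Hdiv Ω),
      IsSchemePair c T ΘI M N τ Θ q p u Θn qn pn un →
      ∃ Q, IsEulerApproximation (fieldₗ Ω) (divₗ Ω) c.sat T ΘI Bf A τ N
        Θ q (fun t => c.lowerFlux (Θ t) (u t).field) Q
        Θn qn (fun n => c.lowerFlux (Θn n) (un n).field) := by
  obtain ⟨L, B, hS⟩ := hc.exists_isSaturationMap hΩb (Ω := Ω)
  obtain ⟨Bf, hBf⟩ := hc.exists_norm_lowerFlux_le hd hΩb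
  obtain ⟨K, hK⟩ := hc.exists_norm_lowerFlux_sub_le_of_isDarcyPair hd hΩb (abs_nonneg M)
  have hL := hS.pos
  refine ⟨K ^ 2 * L, Bf, by positivity, fun N τ Θ q p u Θn qn pn un h => ?_⟩
  obtain ⟨Q, hQ⟩ := h.continuous.exists_isFlow hc hΩb (abs_nonneg M) h.ae_velocity_le_abs hBf
  refine ⟨Q, hQ, h.discrete.isEulerFlow hBf, h.step_pos hT, h.timePoint_eq, fun n hn => ?_⟩
  filter_upwards [h.ae_of_isDarcyPair hK hn] with t ht
  calc ‖c.lowerFlux (Θ t) (u t).field - c.lowerFlux (Θn n) (un n).field‖ ^ 2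
      ≤ (K * ‖c.sat (Θ t) - c.sat (Θn n)‖) ^ 2 := by gcongr
    _ ≤ K ^ 2 * (L * ⟪c.sat (Θ t) - c.sat (Θn n), Θ t - Θn n⟫_ℝ) := by
        rw [mul_pow]
        gcongr
        exact hS.cocoercive (Θ t) (Θn n)
    _ = K ^ 2 * L * ⟪c.sat (Θ t) - c.sat (Θn n), Θ t - Θn n⟫_ℝ := (mul_assoc _ _ _).symm

theorem exists_timeMean_error_le (hc : c.Admissible) (hd : 1 ≤ d) (hΩb : Bornology.IsBounded Ω)
    (hT : 0 < T) (ΘI : L2 Ω) (M : ℝ) :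
    ∃ C, ∀ (N : ℕ) (τ : ℝ) (Θ : ℝ → L2 Ω) (q : ℝ → L2vec Ω) (p : ℝ → L2 Ω)
      (u : ℝ → Hdiv Ω) (Θn : ℕ → L2 Ω) (qn : ℕ → Hdiv Ω) (pn : ℕ → L2 Ω) (un : ℕ → Hdiv Ω),
      IsSchemePair c T ΘI M N τ Θ q p u Θn qn pn un → ∀ n ∈ Finset.Icc 1 N,
      τ * ‖timeMean τ (fun t => (u t).field) n - (un n).field‖ ^ 2
          + τ * ‖timeMean τ p n - pn n‖ ^ 2
        ≤ C * stepIntegral τ (fun t => ‖c.sat (Θ t) - c.sat (Θn n)‖ ^ 2) n := by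
  obtain ⟨L, B, hS⟩ := hc.exists_isSaturationMap hΩb (Ω := Ω)
  obtain ⟨C, -, hdarcy⟩ := hc.exists_norm_darcyPair_sub_le hd hΩb (abs_nonneg M)
  refine ⟨2 * C ^ 2, fun N τ Θ q p u Θn qn pn un h n hn => ?_⟩
  have hτ := h.step_pos hT
  have hn' := Finset.mem_Icc.1 hn
  have hnT : timePoint τ n ≤ T := h.timePoint_eq ▸ timePoint_mono hτ.le hn'.2
  have hsat : IntegrableOn (fun t => ‖c.sat (Θ t) - c.sat (Θn n)‖ ^ 2) (Ioc 0 T) :=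
    integrable_norm_sq ((hS.memLp_comp h.continuous.Θ_mem.memLp_Ioc.1).sub (memLp_const _))
  have herror := h.ae_of_isDarcyPair hdarcy hn
  have hvelocity := mul_norm_timeMean_sub_sq_le hτ hn'.1 hnT
    (memLp_field h.continuous.u_mem.memLp_Ioc) (un n).field hsat (herror.mono fun t ht => ht.1)
  have hpressure := mul_norm_timeMean_sub_sq_le hτ hn'.1 hnT
    h.continuous.p_mem.memLp_Ioc (pn n) hsat (herror.mono fun t ht => ht.2)
  linear_combination hvelocity + hpressure

end Coeffs.Admissible

end Scheme

end TwoPhase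

end

theorem mainTheorem6_general {d : ℕ} (hd : 1 ≤ d) {Ω : Set (TwoPhase.Space d)}
    (hΩb : Bornology.IsBounded Ω) {T : ℝ} (hT : 0 < T) {c : TwoPhase.Coeffs d}
    (hc : c.Admissible) (ΘI : TwoPhase.L2 Ω) (Mu : ℝ) :
    ∃ C τ₀ : ℝ, 0 < C ∧ 0 < τ₀ ∧
      ∀ (N : ℕ) (τ : ℝ) (Θ : ℝ → TwoPhase.L2 Ω) (q : ℝ → TwoPhase.L2vec Ω)
        (p : ℝ → TwoPhase.L2 Ω) (u : ℝ → TwoPhase.Hdiv Ω) (Θn : ℕ → TwoPhase.L2 Ω)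
        (qn : ℕ → TwoPhase.Hdiv Ω) (pn : ℕ → TwoPhase.L2 Ω) (un : ℕ → TwoPhase.Hdiv Ω),
        TwoPhase.IsSchemePair c T ΘI Mu N τ Θ q p u Θn qn pn un → τ ≤ τ₀ →
        (∑ n ∈ Finset.Icc 1 N, TwoPhase.saturationError c.sat τ Θ Θn n
            + ‖TwoPhase.fluxError (TwoPhase.fieldₗ Ω) τ q qn N‖ ^ 2
            + ∑ n ∈ Finset.Icc 1 N,
                ‖TwoPhase.stepIntegral τ (fun t => q t - (qn n).field) n‖ ^ 2
          ≤ C * τ) ∧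
        (∀ n ∈ Finset.Icc 1 N,
          τ * ‖TwoPhase.timeMean τ (fun t => (u t).field) n - (un n).field‖ ^ 2
              + τ * ‖TwoPhase.timeMean τ p n - pn n‖ ^ 2
            ≤ C * TwoPhase.stepIntegral τ (fun t => ‖c.sat (Θ t) - c.sat (Θn n)‖ ^ 2) n) ∧
        ‖∑ n ∈ Finset.Icc 1 N, TwoPhase.stepIntegral τ (fun t => Θ t - Θn n) n‖ ^ 2
          ≤ C * τ := by
  obtain ⟨Ci, hCi, hinf⟩ := TwoPhase.exists_infSup hd hΩb
  obtain ⟨L, B, hS⟩ := hc.exists_isSaturationMap hΩb (Ω := Ω)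
  obtain ⟨A, Bf, hA, hscheme⟩ := hc.exists_isEulerApproximation hd hΩb hT ΘI Mu
  obtain ⟨K, τ₀, hτ₀, herror⟩ :=
    TwoPhase.exists_isEulerApproximation_error_le hA hS hCi hinf T ΘI Bf
  obtain ⟨C, hmean⟩ := hc.exists_timeMean_error_le hd hΩb hT ΘI Mu
  refine ⟨max (max K C) 1, τ₀, by positivity, hτ₀,
    fun N τ Θ q p u Θn qn pn un h hτ => ?_⟩
  obtain ⟨Q, hQ⟩ := hscheme _ _ _ _ _ _ _ _ _ _ h
  obtain ⟨hflux, hΘ⟩ := herror _ _ _ _ _ _ _ _ _ hQ hτ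
  have hτ_pos := h.step_pos hT
  have hK : K ≤ max (max K C) 1 := (le_max_left _ _).trans (le_max_left _ _)
  have hC : C ≤ max (max K C) 1 := (le_max_right _ _).trans (le_max_left _ _)
  refine ⟨hflux.trans (by gcongr), fun n hn => ?_, hΘ.trans (by gcongr)⟩
  exact (hmean _ _ _ _ _ _ _ _ _ _ h n hn).trans
    (mul_le_mul_of_nonneg_right hC
      (TwoPhase.stepIntegral_nonneg hτ_pos.le (fun _ => sq_nonneg _) n))

theorem mainTheorem6 {d : ℕ} (hd : 1 ≤ d) (Ω : Set (TwoPhase.Space d)) (hΩ : IsOpen Ω)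
    (hΩb : Bornology.IsBounded Ω) (T : ℝ) (hT : 0 < T) (c : TwoPhase.Coeffs d)
    (hc : c.Admissible) (ΘI : TwoPhase.L2 Ω) (Mu : ℝ) :
    ∃ C τ₀ : ℝ, 0 < C ∧ 0 < τ₀ ∧
      ∀ (Θ : ℝ → TwoPhase.L2 Ω) (q : ℝ → TwoPhase.L2vec Ω) (p : ℝ → TwoPhase.L2 Ω)
        (u : ℝ → TwoPhase.Hdiv Ω),
        TwoPhase.IsContinuousSolution c Ω T ΘI Θ q p u →
        (∀ᵐ t ∂((volume : Measure ℝ).restrict (Ioo 0 T)),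
          ∀ᵐ x ∂((volume : Measure (TwoPhase.Space d)).restrict Ω), ‖(u t).field x‖ ≤ Mu) →
      ∀ (N : ℕ) (τ : ℝ), 1 ≤ N → τ = T / N → τ ≤ τ₀ →
      ∀ (Θn : ℕ → TwoPhase.L2 Ω) (qn : ℕ → TwoPhase.Hdiv Ω) (pn : ℕ → TwoPhase.L2 Ω)
        (un : ℕ → TwoPhase.Hdiv Ω),
        TwoPhase.IsSemiDiscreteSolution c Ω τ N ΘI Θn qn pn un →
        ((∑ n ∈ Finset.Icc 1 N, ∫ t in TwoPhase.timePoint τ (n - 1)..TwoPhase.timePoint τ n,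
              ⟪c.sat (Θ t) - c.sat (Θn n), Θ t - Θn n⟫_ℝ)
            + ‖∑ n ∈ Finset.Icc 1 N, ∫ t in TwoPhase.timePoint τ (n - 1)..TwoPhase.timePoint τ n,
                (q t - (qn n).field)‖ ^ 2
            + ∑ n ∈ Finset.Icc 1 N,
                ‖∫ t in TwoPhase.timePoint τ (n - 1)..TwoPhase.timePoint τ n,
                  (q t - (qn n).field)‖ ^ 2
          ≤ C * τ) ∧
        (∀ n ∈ Finset.Icc 1 N,
          τ * ‖TwoPhase.timeMean τ (fun t => (u t).field) n - (un n).field‖ ^ 2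
              + τ * ‖TwoPhase.timeMean τ p n - pn n‖ ^ 2
            ≤ C * ∫ t in TwoPhase.timePoint τ (n - 1)..TwoPhase.timePoint τ n,
                ‖c.sat (Θ t) - c.sat (Θn n)‖ ^ 2) ∧
        ‖∑ n ∈ Finset.Icc 1 N, ∫ t in TwoPhase.timePoint τ (n - 1)..TwoPhase.timePoint τ n,
            (Θ t - Θn n)‖ ^ 2 ≤ C * τ := by
  obtain ⟨C, τ₀, hC, hτ₀, h⟩ := mainTheorem6_general hd hΩb hT hc ΘI Mu
  exact ⟨C, τ₀, hC, hτ₀, fun _ _ _ _ hsol hu _ _ hN hτN hτ _ _ _ _ hn =>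
    h _ _ _ _ _ _ _ _ _ _ ⟨hsol, hu, hN, hτN, hn⟩ hτ⟩
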